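/- Let $M$ be a smooth manifold (Hausdorff, finite-dimensional, without boundary). Let $C^{-\infty}(M)$ denote the space of distributions on $M$, i.e. the topological dual of the space $C_c^\infty(M)$ of complex-valued compactly supported smooth functions, and similarly for $C^{-\infty}(\mathbb R)$ and $C^{-\infty}(M\times\mathbb R)$. For $v\in C^{-\infty}(M)$ and $T\in C^{-\infty}(\mathbb R)$ let $v\otimes T\in C^{-\infty}(M\times\mathbb R)$ be the tensor product, $\langle v\otimes T,\varphi\rangle=\langle v,\ p\mapsto\langle T,\varphi(p,\cdot)\rangle\rangle$, and put $C^{-\infty}(M)\otimes T=\{v\otimes T : v\in C^{-\infty}(M)\}$. Let $\alpha_s(p,t)=(p,st)$ for $s>0$ and $(p,t)\in M\times\mathbb R$. For $a\in\mathbb C$ let $H^a_\alpha(M\times\mathbb R)$ be the space of $a$-homogeneous distributions, i.e. of those $u\in C^{-\infty}(M\times\mathbb R)$ with $\langle u,\varphi\circ\alpha_{s^{-1}}\rangle=s^a\langle u,\varphi\rangle$ for all $s>0$ and all $\varphi\in C_c^\infty(M\times\mathbb R)$. Let $-\mathbb N=\{0,-1,-2,\dots\}$. Set $k=0$ if $\operatorname{Re}a>0$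 and $k=\lfloor-\operatorname{Re}a\rfloor+1$ if $\operatorname{Re}a\le 0$. Define $t_+^{a-1}\in C^{-\infty}(\mathbb R)$ by $$\langle t_+^{a-1},\varphi\rangle=\int_0^\infty t^{a-1+k}\,\frac{(-1)^k\varphi^{(k)}(t)}{a(a+1)\cdots(a+k-1)}\,dt\quad\text{if } a\notin-\mathbb N,$$ $$\langle t_+^{a-1},\varphi\rangle=\int_0^\infty \ln(t)\,\frac{(-1)^k\varphi^{(k)}(t)}{a(a+1)\cdots(a+k-2)}\,dt\quad\text{if } a\in-\mathbb N$$ (an empty product is $1$), and define $t_-^{a-1}$ by $\langle t_-^{a-1},\varphi\rangle=\langle t_+^{a-1},\varphi(-\,\cdot)\rangle$. Let $\langle\partial_t^n\delta_0,\varphi\rangle=(-1)^n\varphi^{(n)}(0)$. Then, with internal direct sums of vector spaces: - if $a\in\mathbb C\setminus(-\mathbb N)$, then $$H^a_\alpha(M\times\mathbb R)=C^{-\infty}(M)\otimes t_+^{a-1}\ \oplus\ C^{-\infty}(M)\otimes t_-^{a-1};$$ - if $a\in-\mathbb N$, then $$H^a_\alpha(M\times\mathbb R)=C^{-\infty}(M)\otimes\bigl(t_+^{a-1}+(-1)^{a-1}t_-^{a-1}\bigr)\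 \oplus\ C^{-\infty}(M)\otimes\partial_t^{-a}\delta_0.$$ -/

import Mathlib

open Set Filter Topology MeasureTheory
open scoped Manifold ContDiff

namespace HomDist

section General

variable {E : Type*} [NormedAddCommGroup E] [NormedSpace ℝ E]
  {H : Type*} [TopologicalSpace H] (I : ModelWithCorners ℝ E H)
  (M : Type*) [TopologicalSpace M] [ChartedSpace H M]

/-- The space `C_c^∞(M)` of complex-valued smooth functions with compact support. -/
noncomputable def testFunctions : Submodule ℂ (M → ℂ) where
  carrier := {f | ContMDiff I 𝓘(ℝ, ℂ) ∞ f ∧ HasCompactSupport f}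
  add_mem' := fun hf hg => ⟨hf.1.add hg.1, hf.2.add hg.2⟩
  zero_mem' := ⟨contMDiff_const, HasCompactSupport.zero⟩
  smul_mem' := fun c f hf => ⟨by
    have : ContMDiff I 𝓘(ℝ, ℂ) ∞ ((fun z : ℂ => c • z) ∘ f) :=
      (ContDiff.contMDiff (by fun_prop)).comp hf.1
    exact this, hf.2.smul_left (f := fun _ => c)⟩

variable {I M}

/-- `φ j → 0` in `C_c^∞(M)`: the supports lie in one compact set, and in every chart all partial
derivatives of all orders tend to `0` uniformly on compact sets. (The models in use have no
boundary, so that the domain `(extChartAt I x).target` of a chart is open in `E`.) -/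
def TendstoZero (φ : ℕ → testFunctions I M) : Prop :=
  (∃ K : Set M, IsCompact K ∧ ∀ j, tsupport (φ j : M → ℂ) ⊆ K) ∧
  ∀ (x : M) (L : Set E), IsCompact L → L ⊆ (extChartAt I x).target →
    ∀ (k : ℕ) (h : Fin k → E),
      TendstoUniformlyOn
        (fun j y => iteratedFDeriv ℝ k ((φ j : M → ℂ) ∘ (extChartAt I x).symm) y h)
        (fun _ => 0) atTop L

variable (I M)

/-- The space `C^{-∞}(M)` of distributions: the continuous linear functionals on `C_c^∞(M)`.
As `C_c^∞(M)` is the inductive limit of the metrizable spaces of smooth functions supported in a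
fixed compact set, a linear functional is continuous iff it is sequentially continuous at `0`. -/
noncomputable def distributions : Submodule ℂ (testFunctions I M →ₗ[ℂ] ℂ) where
  carrier := {u | ∀ φ : ℕ → testFunctions I M, TendstoZero φ →
    Tendsto (fun j => u (φ j)) atTop (𝓝 0)}
  add_mem' := fun hu hv φ hφ => by simpa using (hu φ hφ).add (hv φ hφ)
  zero_mem' := fun φ hφ => by simp
  smul_mem' := fun c u hu φ hφ => by simpa using (hu φ hφ).const_mul c

variable {I M}

/-- The pull-back `f^* φ = φ ∘ f` of a test function by a diffeomorphism. -/
noncomputable def pullback (f : M ≃ₘ^∞⟮I, I⟯ M) (φ : testFunctions I M) : testFunctions I M :=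
  ⟨(φ : M → ℂ) ∘ f, φ.2.1.comp f.contMDiff, φ.2.2.comp_homeomorph f.toHomeomorph⟩

/-- The space `H^a_α(M)` of the distributions that are positively homogeneous of degree `a` for a
family `α` of diffeomorphisms indexed by `s > 0`: those with
`⟨α_s^* u, φ⟩ := ⟨u, α_{s⁻¹}^* φ⟩ = s^a ⟨u, φ⟩` for all `s > 0` and all test functions `φ`. -/
noncomputable def homogeneous (α : {s : ℝ // 0 < s} → M ≃ₘ^∞⟮I, I⟯ M) (a : ℂ) :
    Submodule ℂ (distributions I M) where
  carrier := {u | ∀ (s : {s : ℝ // 0 < s}) (φ : testFunctions I M),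
    u.1 (pullback (α s⁻¹) φ) = ((s : ℝ) : ℂ) ^ a * u.1 φ}
  add_mem' := fun hu hv s φ => by
    have h1 := hu s φ
    have h2 := hv s φ
    simp only [Submodule.coe_add, LinearMap.add_apply, h1, h2, mul_add]
  zero_mem' := fun s φ => by simp
  smul_mem' := fun c u hu s φ => by
    have h1 := hu s φ
    simp only [Submodule.coe_smul, LinearMap.smul_apply, h1, smul_eq_mul]
    ring

variable (I M)

/-- The dilation `α_s (p, t) = (p, s t)` of `M × ℝ`. -/
noncomputable def dilation (s : {s : ℝ // 0 < s}) :
    (M × ℝ) ≃ₘ^∞⟮I.prod 𝓘(ℝ, ℝ), I.prod 𝓘(ℝ, ℝ)⟯ (M × ℝ) where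
  toFun := fun x => (x.1, (s : ℝ) * x.2)
  invFun := fun x => (x.1, (s : ℝ)⁻¹ * x.2)
  left_inv := fun x => by simp [inv_mul_cancel_left₀ s.2.ne']
  right_inv := fun x => by simp [mul_inv_cancel_left₀ s.2.ne']
  contMDiff_toFun := contMDiff_fst.prodMk
    ((ContDiff.contMDiff (by fun_prop : ContDiff ℝ ∞ fun t : ℝ => (s : ℝ) * t)).comp
      contMDiff_snd)
  contMDiff_invFun := contMDiff_fst.prodMk
    ((ContDiff.contMDiff (by fun_prop : ContDiff ℝ ∞ fun t : ℝ => (s : ℝ)⁻¹ * t)).comp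
      contMDiff_snd)

end General

/-! ### Distributions on the line -/

section Line

theorem testFunctions_real_contDiff (ψ : testFunctions 𝓘(ℝ, ℝ) ℝ) :
    ContDiff ℝ ∞ (ψ : ℝ → ℂ) := contMDiff_iff_contDiff.1 ψ.2.1

theorem extChartAt_real (x : ℝ) : extChartAt 𝓘(ℝ, ℝ) x = PartialEquiv.refl ℝ :=
  extChartAt_model_space_eq_id ℝ x

theorem tendstoZero_real_iff (ψ : ℕ → testFunctions 𝓘(ℝ, ℝ) ℝ) :
    TendstoZero ψ ↔ (∃ R : ℝ, ∀ j t, R < |t| → (ψ j : ℝ → ℂ) t = 0) ∧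
      ∀ k : ℕ, TendstoUniformly (fun j t => iteratedDeriv k (ψ j : ℝ → ℂ) t)
        (fun _ => 0) atTop := by
  have key : ∀ (R : ℝ) (j : ℕ), (∀ t, R < |t| → (ψ j : ℝ → ℂ) t = 0) →
      ∀ (k : ℕ) (t : ℝ), R < |t| → iteratedDeriv k (ψ j : ℝ → ℂ) t = 0 := by
    intro R j hR k t ht
    have h0 : (ψ j : ℝ → ℂ) =ᶠ[𝓝 t] fun _ => (0 : ℂ) := by
      filter_upwards [(isOpen_lt continuous_const continuous_abs).mem_nhds ht] with s hs
      exact hR s hs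
    rw [h0.iteratedDeriv_eq]
    simp
  constructor
  · rintro ⟨⟨K, hK, hKs⟩, h⟩
    obtain ⟨R, hR⟩ := hK.isBounded.subset_closedBall (0 : ℝ)
    have hR' : ∀ j t, R < |t| → (ψ j : ℝ → ℂ) t = 0 := by
      intro j t ht
      by_contra hne
      have := hR (hKs j (subset_tsupport _ hne))
      simp only [Metric.mem_closedBall, dist_zero_right, Real.norm_eq_abs] at this
      linarith
    refine ⟨⟨R, hR'⟩, fun k => ?_⟩
    have h1 := h 0 (Metric.closedBall 0 R) (isCompact_closedBall _ _)
      (by rw [extChartAt_real]; exact subset_univ _) k (fun _ => 1)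
    rw [extChartAt_real, Metric.tendstoUniformlyOn_iff] at h1
    rw [Metric.tendstoUniformly_iff]
    intro ε hε
    filter_upwards [h1 ε hε] with j hj t
    by_cases ht : R < |t|
    · rw [key R j (hR' j) k t ht]
      simpa using hε
    · have := hj t (by simpa using ht)
      simpa [iteratedDeriv_eq_iteratedFDeriv] using this
  · rintro ⟨⟨R, hR⟩, h⟩
    refine ⟨⟨Metric.closedBall 0 R, isCompact_closedBall _ _, fun j => ?_⟩, ?_⟩
    · refine closure_minimal (fun t ht => ?_) Metric.isClosed_closedBall
      by_contra hne
      exact ht (hR j t (by simpa using hne))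
    · intro x L _ _ k v
      have h1 := h k
      rw [Metric.tendstoUniformly_iff] at h1
      rw [Metric.tendstoUniformlyOn_iff]
      intro ε hε
      have hc : 0 < ε / (|∏ i, v i| + 1) := by positivity
      filter_upwards [h1 _ hc] with j hj t _
      have h2 := hj t
      rw [dist_zero_left] at h2 ⊢
      have h3 : iteratedFDeriv ℝ k ((ψ j : ℝ → ℂ) ∘ (extChartAt 𝓘(ℝ, ℝ) x).symm) t v
          = (∏ i, v i) • iteratedDeriv k (ψ j : ℝ → ℂ) t := by
        rw [← iteratedFDeriv_apply_eq_iteratedDeriv_mul_prod, extChartAt_real]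
        rfl
      rw [h3, norm_smul, Real.norm_eq_abs]
      rw [lt_div_iff₀ (by positivity)] at h2
      nlinarith [norm_nonneg (iteratedDeriv k (ψ j : ℝ → ℂ) t), abs_nonneg (∏ i, v i)]

theorem exists_bound_support (ψ : testFunctions 𝓘(ℝ, ℝ) ℝ) :
    ∃ R : ℝ, ∀ t, R < |t| → (ψ : ℝ → ℂ) t = 0 := by
  obtain ⟨R, hR⟩ := ψ.2.2.isCompact.isBounded.subset_closedBall (0 : ℝ)
  refine ⟨R, fun t ht => ?_⟩
  by_contra hne
  have := hR (subset_tsupport _ hne)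
  simp only [Metric.mem_closedBall, dist_zero_right, Real.norm_eq_abs] at this
  linarith

theorem iteratedDeriv_eq_zero_of_support {f : ℝ → ℂ} {R : ℝ} (hR : ∀ t, R < |t| → f t = 0)
    (k : ℕ) (t : ℝ) (ht : R < |t|) : iteratedDeriv k f t = 0 := by
  have h0 : f =ᶠ[𝓝 t] fun _ => (0 : ℂ) := by
    filter_upwards [(isOpen_lt continuous_const continuous_abs).mem_nhds ht] with s hs
    exact hR s hs
  rw [h0.iteratedDeriv_eq]
  simp

/-- The distribution `∂_t^n δ₀`, `φ ↦ (-1)^n φ^{(n)}(0)`. -/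
noncomputable def diracDeriv (n : ℕ) : distributions 𝓘(ℝ, ℝ) ℝ :=
  ⟨{ toFun := fun φ => (-1) ^ n * iteratedDeriv n (φ : ℝ → ℂ) 0
     map_add' := fun φ ψ => by
      rw [Submodule.coe_add, iteratedDeriv_add
        ((testFunctions_real_contDiff φ).contDiffAt.of_le (by exact_mod_cast le_top))
        ((testFunctions_real_contDiff ψ).contDiffAt.of_le (by exact_mod_cast le_top)), mul_add]
     map_smul' := fun c φ => by
      rw [Submodule.coe_smul, iteratedDeriv_const_smul_field]
      simp only [smul_eq_mul, RingHom.id_apply]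
      ring },
   fun φ hφ => by
    have h := ((tendstoZero_real_iff φ).1 hφ).2 n
    simpa using (h.tendsto_at 0).const_mul ((-1 : ℂ) ^ n)⟩

theorem integrableOn_weight_mul {w : ℝ → ℂ} (hw : ∀ R : ℝ, IntegrableOn w (Ioc 0 R)) (k : ℕ)
    (φ : testFunctions 𝓘(ℝ, ℝ) ℝ) :
    IntegrableOn (fun t => w t * iteratedDeriv k (φ : ℝ → ℂ) t) (Ioi 0) := by
  obtain ⟨R, hR⟩ := exists_bound_support φ
  have hc : Continuous (iteratedDeriv k (φ : ℝ → ℂ)) :=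
    (testFunctions_real_contDiff φ).continuous_iteratedDeriv k (by exact_mod_cast le_top)
  have h1 : IntegrableOn (fun t => w t * iteratedDeriv k (φ : ℝ → ℂ) t) (Ioc 0 |R|) := by
    obtain ⟨C, hC⟩ := (isCompact_Icc (a := (0 : ℝ)) (b := |R|)).exists_bound_of_continuousOn
      hc.continuousOn
    refine (hw |R|).mul_bdd (c := C) hc.aestronglyMeasurable ?_
    filter_upwards [ae_restrict_mem measurableSet_Ioc] with t ht
    exact hC t ⟨ht.1.le, ht.2⟩
  refine h1.of_forall_sdiff_eq_zero measurableSet_Ioi fun t ht => ?_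
  rw [iteratedDeriv_eq_zero_of_support hR, mul_zero]
  have h2 : |R| < t := by
    by_contra hcon
    exact ht.2 ⟨ht.1, not_lt.1 hcon⟩
  exact lt_of_lt_of_le (lt_of_le_of_lt (le_abs_self R) h2) (le_abs_self t)

/-- For `w` integrable near `0` and locally integrable on `]0, ∞[`, the distribution
`φ ↦ ∫_0^∞ w(t) φ^{(k)}(t) dt`. -/
noncomputable def integralDeriv (w : ℝ → ℂ) (hw : ∀ R : ℝ, IntegrableOn w (Ioc 0 R)) (k : ℕ) :
    distributions 𝓘(ℝ, ℝ) ℝ :=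
  ⟨{ toFun := fun φ => ∫ t in Ioi (0 : ℝ), w t * iteratedDeriv k (φ : ℝ → ℂ) t
     map_add' := fun φ ψ => by
      rw [← integral_add (integrableOn_weight_mul hw k φ) (integrableOn_weight_mul hw k ψ)]
      congr 1
      ext t
      rw [Submodule.coe_add, iteratedDeriv_add
        ((testFunctions_real_contDiff φ).contDiffAt.of_le (by exact_mod_cast le_top))
        ((testFunctions_real_contDiff ψ).contDiffAt.of_le (by exact_mod_cast le_top)), mul_add]
     map_smul' := fun c φ => by
      rw [RingHom.id_apply, ← integral_smul]
      congr 1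
      ext t
      rw [Submodule.coe_smul, iteratedDeriv_const_smul_field]
      simp only [smul_eq_mul]
      ring },
   fun φ hφ => by
    obtain ⟨⟨R, hR⟩, h⟩ := (tendstoZero_real_iff φ).1 hφ
    have h1 := Metric.tendstoUniformly_iff.1 (h k)
    simp only [LinearMap.coe_mk, AddHom.coe_mk]
    have hz : ∀ j, ∫ t in Ioi (0 : ℝ), w t * iteratedDeriv k (φ j : ℝ → ℂ) t
        = ∫ t in Ioc (0 : ℝ) |R|, w t * iteratedDeriv k (φ j : ℝ → ℂ) t := by
      intro j
      refine (setIntegral_eq_of_subset_of_forall_sdiff_eq_zero measurableSet_Ioi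
        Ioc_subset_Ioi_self fun t ht => ?_)
      rw [iteratedDeriv_eq_zero_of_support (hR j), mul_zero]
      have h2 : |R| < t := by
        by_contra hcon
        exact ht.2 ⟨ht.1, not_lt.1 hcon⟩
      exact lt_of_lt_of_le (lt_of_le_of_lt (le_abs_self R) h2) (le_abs_self t)
    simp only [hz]
    rw [Metric.tendsto_nhds]
    intro ε hε
    set A := ∫ t in Ioc (0 : ℝ) |R|, ‖w t‖ with hA
    have hA0 : 0 ≤ A := integral_nonneg fun _ => norm_nonneg _
    filter_upwards [h1 (ε / (A + 1)) (by positivity)] with j hj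
    rw [dist_zero_right]
    calc ‖∫ t in Ioc (0 : ℝ) |R|, w t * iteratedDeriv k (φ j : ℝ → ℂ) t‖
        ≤ ∫ t in Ioc (0 : ℝ) |R|, ‖w t‖ * (ε / (A + 1)) := by
          refine norm_integral_le_of_norm_le ((hw |R|).norm.mul_const _) ?_
          refine Eventually.of_forall fun t => ?_
          rw [norm_mul]
          have := hj t
          rw [dist_zero_left] at this
          gcongr
      _ = A * (ε / (A + 1)) := by rw [integral_mul_const]
      _ < ε := by
          rw [mul_div_assoc', div_lt_iff₀ (by positivity)]
          nlinarith⟩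

theorem integrableOn_log (R : ℝ) :
    IntegrableOn (fun t : ℝ => ((Real.log t : ℝ) : ℂ)) (Ioc 0 R) := by
  rcases le_or_gt R 0 with hR | hR
  · simp [Ioc_eq_empty (not_lt.2 hR)]
  · have : IntervalIntegrable Real.log volume 0 R := intervalIntegral.intervalIntegrable_log'
    exact ((intervalIntegrable_iff_integrableOn_Ioc_of_le hR.le).1 this).ofReal

theorem integrableOn_cpow {b : ℂ} (hb : -1 < b.re) (R : ℝ) :
    IntegrableOn (fun t : ℝ => (t : ℂ) ^ b) (Ioc 0 R) := by
  rcases le_or_gt R 0 with hR | hR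
  · simp [Ioc_eq_empty (not_lt.2 hR)]
  · exact (intervalIntegrable_iff_integrableOn_Ioc_of_le hR.le).1
      (intervalIntegral.intervalIntegrable_cpow' hb)

/-- The number `k` of derivatives in the definition of `t_+^{a-1}`: `0` if `Re a > 0`, and
`⌊-Re a⌋ + 1` if `Re a ≤ 0` (so `-a + 1` if `a ∈ -ℕ`). -/
noncomputable def order (a : ℂ) : ℕ := (⌊-a.re⌋ + 1).toNat

theorem neg_one_lt_re (a : ℂ) : -1 < (a - 1 + (order a : ℂ)).re := by
  have h1 : -a.re < ((⌊-a.re⌋ + 1 : ℤ) : ℝ) := by push_cast; exact Int.lt_floor_add_one _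
  have h2 : ((⌊-a.re⌋ + 1 : ℤ) : ℝ) ≤ (order a : ℝ) := by
    exact_mod_cast Int.self_le_toNat (⌊-a.re⌋ + 1)
  simp
  linarith

open Classical in
/-- The distribution `t_+^{a-1}` on `ℝ`. With `k = order a` it maps `φ` to
* `∫_0^∞ t^{a-1+k} (-1)^k φ^{(k)}(t) / (a (a+1) ⋯ (a+k-1)) dt` if `a ∉ -ℕ`
  (that is `∫_0^∞ t^{a-1} φ(t) dt` if `Re a > 0`);
* `∫_0^∞ log(t) (-1)^k φ^{(k)}(t) / (a (a+1) ⋯ (a+k-2)) dt` if `a ∈ -ℕ`. -/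
noncomputable def tPlus (a : ℂ) : distributions 𝓘(ℝ, ℝ) ℝ :=
  if ∃ n : ℕ, a = -(n : ℂ) then
    ((-1) ^ order a / ∏ j ∈ Finset.range (order a - 1), (a + j)) •
      integralDeriv (fun t => ((Real.log t : ℝ) : ℂ)) integrableOn_log (order a)
  else
    ((-1) ^ order a / ∏ j ∈ Finset.range (order a), (a + j)) •
      integralDeriv (fun t => (t : ℂ) ^ (a - 1 + (order a : ℂ)))
        (integrableOn_cpow (neg_one_lt_re a)) (order a)

/-- The reflection `t ↦ -t`. -/
noncomputable def reflection : ℝ ≃ₘ^∞⟮𝓘(ℝ, ℝ), 𝓘(ℝ, ℝ)⟯ ℝ where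
  toEquiv := Equiv.neg ℝ
  contMDiff_toFun := ContDiff.contMDiff contDiff_neg
  contMDiff_invFun := ContDiff.contMDiff contDiff_neg

/-- The distribution `t_-^{a-1}`, `φ ↦ ⟨t_+^{a-1}, φ(-t)⟩`. -/
noncomputable def tMinus (a : ℂ) : distributions 𝓘(ℝ, ℝ) ℝ :=
  ⟨{ toFun := fun φ => (tPlus a).1 (pullback reflection φ)
     map_add' := fun φ ψ => (tPlus a).1.map_add (pullback reflection φ) (pullback reflection ψ)
     map_smul' := fun c φ => (tPlus a).1.map_smul c (pullback reflection φ) },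
   fun φ hφ => by
    refine (tPlus a).2 _ ?_
    rw [tendstoZero_real_iff] at hφ ⊢
    obtain ⟨⟨R, hR⟩, h⟩ := hφ
    refine ⟨⟨R, fun j t ht => hR j (-t) (by simpa using ht)⟩, fun k => ?_⟩
    have h1 := h k
    rw [Metric.tendstoUniformly_iff] at h1 ⊢
    intro ε hε
    filter_upwards [h1 ε hε] with j hj t
    have h2 : iteratedDeriv k (pullback reflection (φ j) : ℝ → ℂ) t
        = (-1 : ℝ) ^ k • iteratedDeriv k (φ j : ℝ → ℂ) (-t) :=
      iteratedDeriv_comp_neg k (φ j : ℝ → ℂ) t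
    have h3 := hj (-t)
    rw [dist_zero_left] at h3 ⊢
    rw [h2, norm_smul]
    simpa using h3⟩

end Line

/-! ### Tensor products -/

section Tensor

theorem mem_testFunctions_real {f : ℝ → ℂ} (hf : ContDiff ℝ ∞ f) {R : ℝ}
    (hR : ∀ t, R < |t| → f t = 0) : f ∈ testFunctions 𝓘(ℝ, ℝ) ℝ := by
  refine ⟨contMDiff_iff_contDiff.2 hf, ?_⟩
  refine HasCompactSupport.of_support_subset_isCompact (isCompact_closedBall (0 : ℝ) R) ?_
  intro t ht
  by_contra hne
  exact ht (hR t (by simpa using hne))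

theorem exists_seminorm_bound (T : distributions 𝓘(ℝ, ℝ) ℝ) (R : ℝ) :
    ∃ N : ℕ, ∀ ψ : testFunctions 𝓘(ℝ, ℝ) ℝ, (∀ t, R < |t| → (ψ : ℝ → ℂ) t = 0) →
      ∀ c : ℝ, (∀ k ≤ N, ∀ t, ‖iteratedDeriv k (ψ : ℝ → ℂ) t‖ ≤ c) → ‖T.1 ψ‖ ≤ N * c := by
  by_contra! hcon
  choose ψ hR c hc hT using hcon
  have hc0 : ∀ n, 0 ≤ c n := fun n => (norm_nonneg _).trans (hc n 0 (Nat.zero_le _) 0)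
  have hpos : ∀ n, 0 < ‖T.1 (ψ n)‖ := fun n =>
    lt_of_le_of_lt (mul_nonneg (Nat.cast_nonneg _) (hc0 n)) (hT n)
  have h0 : TendstoZero fun n => (T.1 (ψ n))⁻¹ • ψ n := by
    rw [tendstoZero_real_iff]
    refine ⟨⟨R, fun n t ht => by simp [hR n t ht]⟩, fun k => ?_⟩
    rw [Metric.tendstoUniformly_iff]
    intro ε hε
    obtain ⟨m, hm⟩ := exists_nat_gt (1 / ε)
    filter_upwards [eventually_ge_atTop k, eventually_ge_atTop m] with n hk hn t
    rw [dist_zero_left, Submodule.coe_smul, iteratedDeriv_const_smul_field, norm_smul, norm_inv]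
    have hm' : 1 / ε < n := hm.trans_le (by exact_mod_cast hn)
    have hn0 : (0 : ℝ) < n := lt_trans (by positivity) hm'
    rw [inv_mul_lt_iff₀ (hpos n)]
    rw [div_lt_iff₀ hε] at hm'
    refine (hc n k hk t).trans_lt ?_
    have h1 := hT n
    have h2 : 0 ≤ c n := hc0 n
    have h3 : n * c n * ε < ‖T.1 (ψ n)‖ * ε := by gcongr
    nlinarith
  have h1 := T.2 _ h0
  have h2 : ∀ n, T.1 ((T.1 (ψ n))⁻¹ • ψ n) = 1 := fun n => by
    rw [map_smul, smul_eq_mul, inv_mul_cancel₀ (norm_pos_iff.1 (hpos n))]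
  simp only [h2] at h1
  exact one_ne_zero (tendsto_nhds_unique tendsto_const_nhds h1)

open Classical in
/-- The value `⟨T, f⟩`, extended by `0` to the functions `f` that are not test functions. -/
noncomputable def pairing (T : distributions 𝓘(ℝ, ℝ) ℝ) (f : ℝ → ℂ) : ℂ :=
  if hf : f ∈ testFunctions 𝓘(ℝ, ℝ) ℝ then T.1 ⟨f, hf⟩ else 0

theorem pairing_of_mem (T : distributions 𝓘(ℝ, ℝ) ℝ) {f : ℝ → ℂ}
    (hf : f ∈ testFunctions 𝓘(ℝ, ℝ) ℝ) : pairing T f = T.1 ⟨f, hf⟩ := dif_pos hf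

theorem pairing_add (T : distributions 𝓘(ℝ, ℝ) ℝ) {f g : ℝ → ℂ}
    (hf : f ∈ testFunctions 𝓘(ℝ, ℝ) ℝ) (hg : g ∈ testFunctions 𝓘(ℝ, ℝ) ℝ) :
    pairing T (f + g) = pairing T f + pairing T g := by
  rw [pairing_of_mem T hf, pairing_of_mem T hg,
    pairing_of_mem T ((testFunctions 𝓘(ℝ, ℝ) ℝ).add_mem hf hg), ← map_add]
  rfl

theorem pairing_smul (T : distributions 𝓘(ℝ, ℝ) ℝ) (c : ℂ) {f : ℝ → ℂ}
    (hf : f ∈ testFunctions 𝓘(ℝ, ℝ) ℝ) : pairing T (c • f) = c * pairing T f := by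
  rw [pairing_of_mem T hf, pairing_of_mem T ((testFunctions 𝓘(ℝ, ℝ) ℝ).smul_mem c hf),
    ← smul_eq_mul, ← map_smul]
  rfl

theorem pairing_sub (T : distributions 𝓘(ℝ, ℝ) ℝ) {f g : ℝ → ℂ}
    (hf : f ∈ testFunctions 𝓘(ℝ, ℝ) ℝ) (hg : g ∈ testFunctions 𝓘(ℝ, ℝ) ℝ) :
    pairing T (f - g) = pairing T f - pairing T g := by
  rw [pairing_of_mem T hf, pairing_of_mem T hg,
    pairing_of_mem T ((testFunctions 𝓘(ℝ, ℝ) ℝ).sub_mem hf hg), ← map_sub]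
  rfl

section Calculus

variable {V : Type*} [NormedAddCommGroup V] [NormedSpace ℝ V]

/-- The derivative of `F` in the direction `w`. -/
noncomputable def dirDeriv (w : V) (F : V → ℂ) : V → ℂ := fun z => fderiv ℝ F z w

variable {Ω : Set V}

theorem dirDeriv_smooth (hΩ : IsOpen Ω) (w : V) {F : V → ℂ} (hF : ContDiffOn ℝ ∞ F Ω) :
    ContDiffOn ℝ ∞ (dirDeriv w F) Ω :=
  ((contDiffOn_infty_iff_fderiv_of_isOpen hΩ).1 hF).2.clm_apply contDiffOn_const

theorem dirDeriv_iterate_smooth (hΩ : IsOpen Ω) (w : V) {F : V → ℂ} (hF : ContDiffOn ℝ ∞ F Ω)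
    (k : ℕ) : ContDiffOn ℝ ∞ ((dirDeriv w)^[k] F) Ω := by
  induction k with
  | zero => exact hF
  | succ k ih =>
    rw [Function.iterate_succ_apply']
    exact dirDeriv_smooth hΩ w ih

theorem dirDeriv_congr (hΩ : IsOpen Ω) (w : V) {F G : V → ℂ} (h : EqOn F G Ω) :
    EqOn (dirDeriv w F) (dirDeriv w G) Ω := by
  intro z hz
  have : F =ᶠ[𝓝 z] G := h.eventuallyEq_of_mem (hΩ.mem_nhds hz)
  simp only [dirDeriv, this.fderiv_eq]

theorem dirDeriv_comm (hΩ : IsOpen Ω) (a b : V) {F : V → ℂ} (hF : ContDiffOn ℝ ∞ F Ω) :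
    EqOn (dirDeriv a (dirDeriv b F)) (dirDeriv b (dirDeriv a F)) Ω := by
  intro z hz
  have hs : IsSymmSndFDerivAt ℝ F z :=
    (hF.contDiffAt (hΩ.mem_nhds hz)).isSymmSndFDerivAt
      (by rw [minSmoothness_of_isRCLikeNormedField]; exact WithTop.coe_le_coe.2 le_top)
  have hd : DifferentiableAt ℝ (fderiv ℝ F) z :=
    ((((contDiffOn_infty_iff_fderiv_of_isOpen hΩ).1 hF).2).contDiffAt
      (hΩ.mem_nhds hz)).differentiableAt (by simp)
  have h1 : ∀ a b : V, dirDeriv a (dirDeriv b F) z = fderiv ℝ (fderiv ℝ F) z a b := by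
    intro a b
    have : dirDeriv b F = fun z => fderiv ℝ F z b := rfl
    rw [this, dirDeriv, fderiv_clm_apply hd (differentiableAt_const b)]
    simp
  rw [h1, h1]
  exact hs a b

theorem dirDeriv_iterate_comm (hΩ : IsOpen Ω) (a b : V) {F : V → ℂ} (hF : ContDiffOn ℝ ∞ F Ω)
    (k : ℕ) : EqOn ((dirDeriv b)^[k] (dirDeriv a F)) (dirDeriv a ((dirDeriv b)^[k] F)) Ω := by
  induction k with
  | zero => exact fun z _ => rfl
  | succ k ih =>
    rw [Function.iterate_succ_apply', Function.iterate_succ_apply']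
    exact (dirDeriv_congr hΩ b ih).trans
      (dirDeriv_comm hΩ b a (dirDeriv_iterate_smooth hΩ b hF k))

theorem iteratedFDeriv_dirDeriv (hΩ : IsOpen Ω) (w : V) {F : V → ℂ} (hF : ContDiffOn ℝ ∞ F Ω)
    (k : ℕ) (v : Fin k → V) {z : V} (hz : z ∈ Ω) :
    iteratedFDeriv ℝ k (dirDeriv w F) z v
      = iteratedFDeriv ℝ (k + 1) F z (Fin.snoc (α := fun _ => V) v w) := by
  have h1 : dirDeriv w F = (ContinuousLinearMap.apply ℝ ℂ w) ∘ fderiv ℝ F := rfl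
  have h2 : ContDiffAt ℝ k (fderiv ℝ F) z :=
    ((((contDiffOn_infty_iff_fderiv_of_isOpen hΩ).1 hF).2).contDiffAt
      (hΩ.mem_nhds hz)).of_le (by exact_mod_cast le_top)
  rw [iteratedFDeriv_succ_apply_right, h1,
    ContinuousLinearMap.iteratedFDeriv_comp_left _ h2 le_rfl]
  simp

end Calculus

variable {E : Type*} [NormedAddCommGroup E] [NormedSpace ℝ E]

/-- `F` is smooth on `U × ℝ` and vanishes at `(y, t)` for `|t| > R`. -/
def Admissible (U : Set E) (R : ℝ) (F : E × ℝ → ℂ) : Prop :=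
  ContDiffOn ℝ ∞ F (U ×ˢ univ) ∧ ∀ y ∈ U, ∀ t, R < |t| → F (y, t) = 0

variable {U : Set E} {R : ℝ} {F : E × ℝ → ℂ}

theorem Admissible.dirDeriv (hU : IsOpen U) (hF : Admissible U R F) (w : E × ℝ) :
    Admissible U R (dirDeriv w F) := by
  refine ⟨dirDeriv_smooth (hU.prod isOpen_univ) w hF.1, fun y hy t ht => ?_⟩
  have : F =ᶠ[𝓝 (y, t)] fun _ => 0 := by
    have h1 : IsOpen (U ×ˢ {t : ℝ | R < |t|}) :=
      hU.prod (isOpen_lt continuous_const continuous_abs)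
    filter_upwards [h1.mem_nhds (show (y, t) ∈ U ×ˢ {t : ℝ | R < |t|} from ⟨hy, ht⟩)] with z hz
    exact hF.2 z.1 hz.1 z.2 hz.2
  simp [HomDist.dirDeriv, this.fderiv_eq]

theorem Admissible.iterate (hU : IsOpen U) (hF : Admissible U R F) (w : E × ℝ) (k : ℕ) :
    Admissible U R ((HomDist.dirDeriv w)^[k] F) := by
  induction k with
  | zero => exact hF
  | succ k ih =>
    rw [Function.iterate_succ_apply']
    exact ih.dirDeriv hU w

theorem Admissible.slice_mem (hF : Admissible U R F) {y : E} (hy : y ∈ U) :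
    (fun t => F (y, t)) ∈ testFunctions 𝓘(ℝ, ℝ) ℝ := by
  refine mem_testFunctions_real ?_ (hF.2 y hy)
  rw [← contDiffOn_univ]
  exact hF.1.comp (contDiff_prodMk_right y).contDiffOn fun t _ => ⟨hy, mem_univ _⟩

theorem iteratedDeriv_slice (hU : IsOpen U) {y : E} (hy : y ∈ U) (k : ℕ) :
    ∀ F : E × ℝ → ℂ, ContDiffOn ℝ ∞ F (U ×ˢ univ) →
      iteratedDeriv k (fun t => F (y, t)) = fun t => (dirDeriv (0, 1))^[k] F (y, t) := by
  induction k with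
  | zero => intro F _; simp
  | succ k ih =>
    intro F hF
    have hΩ : IsOpen (U ×ˢ (univ : Set ℝ)) := hU.prod isOpen_univ
    have h1 : deriv (fun t => F (y, t)) = fun t => dirDeriv (0, 1) F (y, t) := by
      ext t
      have hd : DifferentiableAt ℝ F (y, t) :=
        (hF.contDiffAt (hΩ.mem_nhds ⟨hy, mem_univ t⟩)).differentiableAt (by simp)
      exact (hd.hasFDerivAt.comp_hasDerivAt t
        ((hasDerivAt_const t y).prodMk (hasDerivAt_id t))).deriv
    rw [iteratedDeriv_succ', h1, ih _ (dirDeriv_smooth hΩ _ hF)]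
    ext t
    rw [Function.iterate_succ_apply]

/-- The partial pairing `y ↦ ⟨T, F (y, ·)⟩`. -/
noncomputable def partialPairing (T : distributions 𝓘(ℝ, ℝ) ℝ) (F : E × ℝ → ℂ) (y : E) : ℂ :=
  pairing T fun t => F (y, t)

/-- Uniform first-order Taylor estimate. -/
theorem Admissible.taylor (hU : IsOpen U) (hF : Admissible U R F) {y : E} (hy : y ∈ U)
    {ε : ℝ} (hε : 0 < ε) : ∀ᶠ x in 𝓝 y, ∀ t,
      ‖F (x, t) - F (y, t) - HomDist.dirDeriv (x - y, 0) F (y, t)‖ ≤ ε * ‖x - y‖ := by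
  have hΩ : IsOpen (U ×ˢ (univ : Set ℝ)) := hU.prod isOpen_univ
  have hc : ContinuousOn (fderiv ℝ F) (U ×ˢ univ) :=
    ((contDiffOn_infty_iff_fderiv_of_isOpen hΩ).1 hF.1).2.continuousOn
  obtain ⟨v, hv, hv'⟩ := IsCompact.mem_uniformity_of_prod (f := fun x t => fderiv ℝ F (x, t))
    (s := U) (k := Icc (-R) R) (q := y) isCompact_Icc
    (hc.mono (prod_mono_right (subset_univ _))) hy (Metric.dist_mem_uniformity hε)
  rw [hU.nhdsWithin_eq hy] at hv
  obtain ⟨δ, hδ, hδ'⟩ := Metric.mem_nhds_iff.1 (inter_mem hv (hU.mem_nhds hy))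
  filter_upwards [Metric.ball_mem_nhds y hδ] with x hx t
  by_cases ht : R < |t|
  · rw [hF.2 x (hδ' hx).2 t ht, hF.2 y hy t ht, (hF.dirDeriv hU _).2 y hy t ht]
    simpa using mul_nonneg hε.le (norm_nonneg (x - y))
  · have htR : t ∈ Icc (-R) R := abs_le.1 (not_lt.1 ht)
    set ι : E →L[ℝ] E × ℝ := ContinuousLinearMap.inl ℝ E ℝ
    have hder : ∀ z ∈ Metric.ball y δ, HasFDerivWithinAt (fun z => F (z, t))
        ((fderiv ℝ F (z, t)).comp ι) (Metric.ball y δ) z := by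
      intro z hz
      have hd : DifferentiableAt ℝ F (z, t) :=
        (hF.1.contDiffAt (hΩ.mem_nhds ⟨(hδ' hz).2, mem_univ t⟩)).differentiableAt (by simp)
      exact (hd.hasFDerivAt.comp z (hasFDerivAt_prodMk_left z t)).hasFDerivWithinAt
    have hb : ∀ z ∈ Metric.ball y δ,
        ‖(fderiv ℝ F (z, t)).comp ι - (fderiv ℝ F (y, t)).comp ι‖ ≤ ε := by
      intro z hz
      have h1 : dist (fderiv ℝ F (z, t)) (fderiv ℝ F (y, t)) < ε := hv' z (hδ' hz).1 t htR
      rw [dist_eq_norm] at h1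
      rw [← ContinuousLinearMap.sub_comp]
      refine (ContinuousLinearMap.opNorm_comp_le _ _).trans ?_
      have h2 : ‖ι‖ ≤ 1 := ContinuousLinearMap.norm_inl_le_one ℝ E ℝ
      nlinarith [norm_nonneg (fderiv ℝ F (z, t) - fderiv ℝ F (y, t)), norm_nonneg ι]
    exact Convex.norm_image_sub_le_of_norm_hasFDerivWithin_le' hder hb (convex_ball y δ)
      (Metric.mem_ball_self hδ) hx

theorem Admissible.hasFDerivAt [FiniteDimensional ℝ E] (hU : IsOpen U) (hF : Admissible U R F)
    (T : distributions 𝓘(ℝ, ℝ) ℝ) {y : E} (hy : y ∈ U) :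
    ∃ A : E →L[ℝ] ℂ, (∀ h, A h = partialPairing T (HomDist.dirDeriv (h, 0) F) y) ∧
      HasFDerivAt (partialPairing T F) A y := by
  have hm : ∀ h : E, (fun t => HomDist.dirDeriv (h, 0) F (y, t)) ∈ testFunctions 𝓘(ℝ, ℝ) ℝ :=
    fun h => (hF.dirDeriv hU _).slice_mem hy
  let A₀ : E →ₗ[ℝ] ℂ :=
    { toFun := fun h => partialPairing T (HomDist.dirDeriv (h, 0) F) y
      map_add' := fun h h' => by
        rw [partialPairing, partialPairing, partialPairing, ← pairing_add T (hm h) (hm h')]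
        congr 1
        ext t
        simp [HomDist.dirDeriv, ← map_add]
      map_smul' := fun c h => by
        rw [partialPairing, partialPairing, RingHom.id_apply, Complex.real_smul,
          ← pairing_smul T _ (hm h)]
        congr 1
        ext t
        have h1 : ((c • h, 0) : E × ℝ) = c • (h, 0) := by
          rw [Prod.smul_mk, smul_zero]
        rw [HomDist.dirDeriv, h1, map_smul, Complex.real_smul, Pi.smul_apply, smul_eq_mul]
        rfl }
  refine ⟨LinearMap.toContinuousLinearMap A₀, fun h => rfl, ?_⟩
  obtain ⟨N, hN⟩ := exists_seminorm_bound T R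
  rw [hasFDerivAt_iff_isLittleO, Asymptotics.isLittleO_iff]
  intro ε hε
  have hε' : 0 < ε / (N + 1) := by positivity
  have hT : ∀ᶠ x in 𝓝 y, ∀ k ∈ Finset.range (N + 1), ∀ t,
      ‖(HomDist.dirDeriv (0, 1))^[k] F (x, t) - (HomDist.dirDeriv (0, 1))^[k] F (y, t)
        - HomDist.dirDeriv (x - y, 0) ((HomDist.dirDeriv (0, 1))^[k] F) (y, t)‖
        ≤ ε / (N + 1) * ‖x - y‖ := by
    rw [Filter.eventually_all_finset]
    exact fun k _ => (hF.iterate hU (0, 1) k).taylor hU hy hε'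
  filter_upwards [hT, hU.mem_nhds hy] with x hx hxU
  have m1 := hF.slice_mem hxU
  have m2 := hF.slice_mem hy
  have m12 := (testFunctions 𝓘(ℝ, ℝ) ℝ).sub_mem m1 m2
  have m := (testFunctions 𝓘(ℝ, ℝ) ℝ).sub_mem m12 (hm (x - y))
  have e1 : partialPairing T F x - partialPairing T F y
      - LinearMap.toContinuousLinearMap A₀ (x - y) = T.1 ⟨_, m⟩ := by
    rw [← pairing_of_mem T m, pairing_sub T m12 (hm _), pairing_sub T m1 m2]
    rfl
  rw [e1]
  have hΩ : IsOpen (U ×ˢ (univ : Set ℝ)) := hU.prod isOpen_univ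
  have cd : ∀ {f : ℝ → ℂ} (_ : f ∈ testFunctions 𝓘(ℝ, ℝ) ℝ) (k : ℕ) (t : ℝ),
      ContDiffAt ℝ k f t := fun {f} hf k t =>
    ((contMDiff_iff_contDiff.1 hf.1).contDiffAt).of_le (by exact_mod_cast le_top)
  have hb := hN ⟨_, m⟩ (fun t ht => by
      simp [hF.2 x hxU t ht, hF.2 y hy t ht, (hF.dirDeriv hU (x - y, 0)).2 y hy t ht])
    (ε / (N + 1) * ‖x - y‖) (fun k hk t => by
      have h1 := hx k (by simpa using Nat.lt_succ_of_le hk) t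
      have h2 : iteratedDeriv k ((fun t => F (x, t)) - (fun t => F (y, t))
          - fun t => HomDist.dirDeriv (x - y, 0) F (y, t)) t
          = (HomDist.dirDeriv (0, 1))^[k] F (x, t) - (HomDist.dirDeriv (0, 1))^[k] F (y, t)
        - HomDist.dirDeriv (x - y, 0) ((HomDist.dirDeriv (0, 1))^[k] F) (y, t) := by
        rw [iteratedDeriv_sub (cd m12 k t) (cd (hm _) k t),
          iteratedDeriv_sub (cd m1 k t) (cd m2 k t),
          iteratedDeriv_slice hU hxU k F hF.1, iteratedDeriv_slice hU hy k F hF.1,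
          iteratedDeriv_slice hU hy k _ (hF.dirDeriv hU _).1]
        have h3 := dirDeriv_iterate_comm hΩ (x - y, 0) (0, 1) hF.1 k
          (show (y, t) ∈ U ×ˢ (univ : Set ℝ) from ⟨hy, mem_univ t⟩)
        simp only [h3]
      exact h2 ▸ h1)
  refine hb.trans ?_
  rw [← mul_assoc]
  refine mul_le_mul_of_nonneg_right ?_ (norm_nonneg _)
  rw [mul_div_assoc', div_le_iff₀ (by positivity)]
  nlinarith

theorem Admissible.dirDeriv_partialPairing [FiniteDimensional ℝ E] (hU : IsOpen U)
    (hF : Admissible U R F) (T : distributions 𝓘(ℝ, ℝ) ℝ) (h : E) :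
    EqOn (HomDist.dirDeriv h (partialPairing T F))
      (partialPairing T (HomDist.dirDeriv (h, 0) F)) U := by
  intro y hy
  obtain ⟨A, hA, hA'⟩ := hF.hasFDerivAt hU T hy
  rw [HomDist.dirDeriv, hA'.fderiv, hA]

theorem contDiffOn_partialPairing [FiniteDimensional ℝ E] (hU : IsOpen U)
    (T : distributions 𝓘(ℝ, ℝ) ℝ) (n : ℕ) : ∀ F : E × ℝ → ℂ, Admissible U R F →
      ContDiffOn ℝ n (partialPairing T F) U := by
  have hdiff : ∀ F : E × ℝ → ℂ, Admissible U R F →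
      DifferentiableOn ℝ (partialPairing T F) U := fun F hF y hy => by
    obtain ⟨A, _, hA'⟩ := hF.hasFDerivAt hU T hy
    exact hA'.differentiableAt.differentiableWithinAt
  induction n with
  | zero => exact fun F hF => contDiffOn_zero.2 (hdiff F hF).continuousOn
  | succ n ih =>
    intro F hF
    push_cast
    rw [contDiffOn_succ_iff_fderiv_apply hU.uniqueDiffOn]
    refine ⟨hdiff F hF, by simp, fun h => ?_⟩
    refine (ih _ (hF.dirDeriv hU (h, 0))).congr fun y hy => ?_
    rw [fderivWithin_of_isOpen hU hy]
    exact hF.dirDeriv_partialPairing hU T h hy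

theorem tendstoUniformlyOn_partialPairing [FiniteDimensional ℝ E] (hU : IsOpen U)
    (T : distributions 𝓘(ℝ, ℝ) ℝ) {L : Set E} (hL : IsCompact L) (hLU : L ⊆ U) (k : ℕ) :
    ∀ (h : Fin k → E) (F : ℕ → E × ℝ → ℂ), (∀ j, Admissible U R (F j)) →
      (∀ (L' : Set (E × ℝ)), IsCompact L' → L' ⊆ U ×ˢ univ → ∀ (m : ℕ) (w : Fin m → E × ℝ),
        TendstoUniformlyOn (fun j z => iteratedFDeriv ℝ m (F j) z w) (fun _ => 0) atTop L') →
      TendstoUniformlyOn (fun j y => iteratedFDeriv ℝ k (partialPairing T (F j)) y h)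
        (fun _ => 0) atTop L := by
  have hΩ : IsOpen (U ×ˢ (univ : Set ℝ)) := hU.prod isOpen_univ
  have hstep : ∀ (w : E × ℝ) (F : ℕ → E × ℝ → ℂ), (∀ j, Admissible U R (F j)) →
      (∀ (L' : Set (E × ℝ)), IsCompact L' → L' ⊆ U ×ˢ univ → ∀ (m : ℕ) (w : Fin m → E × ℝ),
        TendstoUniformlyOn (fun j z => iteratedFDeriv ℝ m (F j) z w) (fun _ => 0) atTop L') →
      ∀ (L' : Set (E × ℝ)), IsCompact L' → L' ⊆ U ×ˢ univ → ∀ (m : ℕ) (v : Fin m → E × ℝ),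
        TendstoUniformlyOn (fun j z => iteratedFDeriv ℝ m (dirDeriv w (F j)) z v)
          (fun _ => 0) atTop L' := by
    intro w F hF hconv L' hL' hL'U m v
    refine (hconv L' hL' hL'U (m + 1) (Fin.snoc (α := fun _ => E × ℝ) v w)).congr ?_
    exact Eventually.of_forall fun j z hz =>
      (iteratedFDeriv_dirDeriv hΩ w (hF j).1 m v (hL'U hz)).symm
  induction k with
  | zero =>
    intro h F hF hconv
    obtain ⟨N, hN⟩ := exists_seminorm_bound T R
    have hit : ∀ (k : ℕ) (F : ℕ → E × ℝ → ℂ), (∀ j, Admissible U R (F j)) →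
        (∀ (L' : Set (E × ℝ)), IsCompact L' → L' ⊆ U ×ˢ univ → ∀ (m : ℕ) (w : Fin m → E × ℝ),
          TendstoUniformlyOn (fun j z => iteratedFDeriv ℝ m (F j) z w) (fun _ => 0) atTop L') →
        TendstoUniformlyOn (fun j z => (dirDeriv (0, 1))^[k] (F j) z) (fun _ => 0) atTop
          (L ×ˢ Icc (-R) R) := by
      intro k
      induction k with
      | zero =>
        intro F _ hconv
        have := hconv (L ×ˢ Icc (-R) R) (hL.prod isCompact_Icc)
          (prod_mono hLU (subset_univ _)) 0 (fun _ => 0)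
        simpa using this
      | succ k ih =>
        intro F hF hconv
        exact ih (fun j => dirDeriv (0, 1) (F j)) (fun j => (hF j).dirDeriv hU _)
          (hstep _ F hF hconv)
    rw [Metric.tendstoUniformlyOn_iff]
    intro ε hε
    have hε' : 0 < ε / (N + 1) := by positivity
    have h1 : ∀ᶠ j in atTop, ∀ k ∈ Finset.range (N + 1), ∀ z ∈ L ×ˢ Icc (-R) R,
        dist (0 : ℂ) ((dirDeriv (0, 1))^[k] (F j) z) < ε / (N + 1) := by
      rw [Filter.eventually_all_finset]
      exact fun k _ => Metric.tendstoUniformlyOn_iff.1 (hit k F hF hconv) _ hε'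
    filter_upwards [h1] with j hj y hy
    rw [dist_zero_left, iteratedFDeriv_zero_apply, partialPairing,
      pairing_of_mem T ((hF j).slice_mem (hLU hy))]
    have hb := hN ⟨_, (hF j).slice_mem (hLU hy)⟩ ((hF j).2 y (hLU hy)) (ε / (N + 1))
      (fun k hk t => by
        have h2 : iteratedDeriv k (fun t => F j (y, t)) t = (dirDeriv (0, 1))^[k] (F j) (y, t) :=
          congrFun (iteratedDeriv_slice hU (hLU hy) k (F j) (hF j).1) t
        change ‖iteratedDeriv k (fun t => F j (y, t)) t‖ ≤ _
        rw [h2]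
        by_cases ht : R < |t|
        · rw [((hF j).iterate hU (0, 1) k).2 y (hLU hy) t ht]
          simpa using hε'.le
        · have h3 := hj k (by simpa using Nat.lt_succ_of_le hk) (y, t)
            ⟨hy, abs_le.1 (not_lt.1 ht)⟩
          rw [dist_zero_left] at h3
          exact h3.le)
    refine hb.trans_lt ?_
    rw [mul_div_assoc', div_lt_iff₀ (by positivity)]
    nlinarith
  | succ k ih =>
    intro h F hF hconv
    refine (ih (Fin.init h) (fun j => dirDeriv (h (Fin.last k), 0) (F j))
      (fun j => (hF j).dirDeriv hU _) (hstep _ F hF hconv)).congr ?_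
    refine Eventually.of_forall fun j y hy => ?_
    have hs : ContDiffOn ℝ ∞ (partialPairing T (F j)) U :=
      contDiffOn_infty.2 fun n => contDiffOn_partialPairing hU T n _ (hF j)
    have h1 := iteratedFDeriv_dirDeriv hU (h (Fin.last k)) hs k (Fin.init h) (hLU hy)
    rw [Fin.snoc_init_self] at h1
    have h2 : dirDeriv (h (Fin.last k)) (partialPairing T (F j)) =ᶠ[𝓝 y]
        partialPairing T (dirDeriv (h (Fin.last k), 0) (F j)) :=
      ((hF j).dirDeriv_partialPairing hU T _).eventuallyEq_of_mem (hU.mem_nhds (hLU hy))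
    change iteratedFDeriv ℝ k (partialPairing T (dirDeriv (h (Fin.last k), 0) (F j))) y
      (Fin.init h) = iteratedFDeriv ℝ (k + 1) (partialPairing T (F j)) y h
    rw [← h1, (Filter.EventuallyEq.iteratedFDeriv ℝ h2 k).eq_of_nhds]

end Tensor

section TensorManifold

variable {E : Type*} [NormedAddCommGroup E] [NormedSpace ℝ E]
  {H : Type*} [TopologicalSpace H] {I : ModelWithCorners ℝ E H}
  {M : Type*} [TopologicalSpace M] [ChartedSpace H M]

/-- The restriction `t ↦ φ (p, t)` of a test function on `M × ℝ`. -/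
noncomputable def slice (φ : testFunctions (I.prod 𝓘(ℝ, ℝ)) (M × ℝ)) (p : M) :
    testFunctions 𝓘(ℝ, ℝ) ℝ :=
  ⟨fun t => (φ : M × ℝ → ℂ) (p, t), φ.2.1.comp (contMDiff_const.prodMk contMDiff_id), by
    refine HasCompactSupport.of_support_subset_isCompact
      (φ.2.2.isCompact.image continuous_snd) ?_
    exact fun t ht => ⟨(p, t), subset_tsupport _ ht, rfl⟩⟩

/-- A test function on `M × ℝ` read in the chart of `M` at `x`. -/
noncomputable def local_rep (x : M) (φ : testFunctions (I.prod 𝓘(ℝ, ℝ)) (M × ℝ)) : E × ℝ → ℂ :=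
  fun z => (φ : M × ℝ → ℂ) ((extChartAt I x).symm z.1, z.2)

theorem local_rep_eq (x : M) (φ : testFunctions (I.prod 𝓘(ℝ, ℝ)) (M × ℝ)) :
    (φ : M × ℝ → ℂ) ∘ (extChartAt (I.prod 𝓘(ℝ, ℝ)) (x, (0 : ℝ))).symm = local_rep x φ := by
  rw [extChartAt_prod, extChartAt_real]
  rfl

theorem local_rep_admissible [IsManifold I ∞ M] (x : M)
    (φ : testFunctions (I.prod 𝓘(ℝ, ℝ)) (M × ℝ)) {R : ℝ}
    (hR : ∀ p t, R < |t| → (φ : M × ℝ → ℂ) (p, t) = 0) :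
    Admissible (extChartAt I x).target R (local_rep x φ) := by
  refine ⟨?_, fun y _ t ht => hR _ t ht⟩
  have h1 := φ.2.1.comp_contMDiffOn
    (contMDiffOn_extChartAt_symm (I := I.prod 𝓘(ℝ, ℝ)) (n := ∞) (x, (0 : ℝ)))
  rw [contMDiffOn_iff_contDiffOn, local_rep_eq, extChartAt_prod, extChartAt_real] at h1
  exact h1

theorem exists_bound_support_prod {K : Set (M × ℝ)} (hK : IsCompact K) :
    ∃ R : ℝ, ∀ φ : testFunctions (I.prod 𝓘(ℝ, ℝ)) (M × ℝ), tsupport (φ : M × ℝ → ℂ) ⊆ K →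
      ∀ p t, R < |t| → (φ : M × ℝ → ℂ) (p, t) = 0 := by
  obtain ⟨R, hR⟩ := (hK.image continuous_snd).isBounded.subset_closedBall (0 : ℝ)
  refine ⟨R, fun φ hφ p t ht => ?_⟩
  by_contra hne
  have := hR ⟨(p, t), hφ (subset_tsupport _ hne), rfl⟩
  simp only [Metric.mem_closedBall, dist_zero_right, Real.norm_eq_abs] at this
  linarith

theorem pairing_slice (T : distributions 𝓘(ℝ, ℝ) ℝ)
    (φ : testFunctions (I.prod 𝓘(ℝ, ℝ)) (M × ℝ)) (p : M) :
    T.1 (slice φ p) = pairing T fun t => (φ : M × ℝ → ℂ) (p, t) :=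
  (pairing_of_mem T (slice φ p).2).symm

theorem partial_tsupport [T2Space M] (T : distributions 𝓘(ℝ, ℝ) ℝ)
    (φ : testFunctions (I.prod 𝓘(ℝ, ℝ)) (M × ℝ)) :
    tsupport (fun p => T.1 (slice φ p)) ⊆ Prod.fst '' tsupport (φ : M × ℝ → ℂ) := by
  refine closure_minimal (fun p hp => ?_) (φ.2.2.isCompact.image continuous_fst).isClosed
  by_contra hne
  refine hp ?_
  have : slice φ p = 0 := by
    ext t
    by_contra h
    exact hne ⟨(p, t), subset_tsupport _ h, rfl⟩
  simp [this]

variable [FiniteDimensional ℝ E] [I.Boundaryless] [IsManifold I ∞ M] [T2Space M]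

/-- The partial pairing `p ↦ ⟨T, φ (p, ·)⟩` of a test function on `M × ℝ` with a distribution
on `ℝ`; it is a test function on `M`. -/
noncomputable def partialApply (T : distributions 𝓘(ℝ, ℝ) ℝ)
    (φ : testFunctions (I.prod 𝓘(ℝ, ℝ)) (M × ℝ)) : testFunctions I M :=
  ⟨fun p => T.1 (slice φ p), by
    intro x
    obtain ⟨R, hR⟩ := exists_bound_support_prod (I := I) φ.2.2.isCompact
    have hadm := local_rep_admissible x φ (hR φ subset_rfl)
    have h1 : ContDiffOn ℝ ∞ (partialPairing T (local_rep x φ)) (extChartAt I x).target :=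
      contDiffOn_infty.2 fun n =>
        contDiffOn_partialPairing (isOpen_extChartAt_target x) T n _ hadm
    have h2 : ContMDiffAt I 𝓘(ℝ, ℂ) ∞
        (partialPairing T (local_rep x φ) ∘ extChartAt I x) x :=
      (h1.contDiffAt (extChartAt_target_mem_nhds x)).contMDiffAt.comp x contMDiffAt_extChartAt
    refine h2.congr_of_eventuallyEq ?_
    filter_upwards [extChartAt_source_mem_nhds (I := I) x] with p hp
    rw [pairing_slice]
    simp only [Function.comp, partialPairing, local_rep, (extChartAt I x).left_inv hp],
    HasCompactSupport.of_support_subset_isCompact (φ.2.2.isCompact.image continuous_fst)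
      ((subset_tsupport _).trans (partial_tsupport T φ))⟩

theorem partialApply_tendstoZero (T : distributions 𝓘(ℝ, ℝ) ℝ)
    {φ : ℕ → testFunctions (I.prod 𝓘(ℝ, ℝ)) (M × ℝ)} (hφ : TendstoZero φ) :
    TendstoZero fun j => partialApply T (φ j) := by
  obtain ⟨⟨K, hK, hKs⟩, h⟩ := hφ
  obtain ⟨R, hR⟩ := exists_bound_support_prod (I := I) hK
  refine ⟨⟨Prod.fst '' K, hK.image continuous_fst, fun j =>
    (partial_tsupport T (φ j)).trans (image_mono (hKs j))⟩, fun x L hL hLU k v => ?_⟩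
  have hadm : ∀ j, Admissible (extChartAt I x).target R (local_rep x (φ j)) := fun j =>
    local_rep_admissible x (φ j) (hR (φ j) (hKs j))
  have heq : ∀ j, (partialApply T (φ j) : M → ℂ) ∘ (extChartAt I x).symm
      = partialPairing T (local_rep x (φ j)) := by
    intro j
    ext y
    exact pairing_slice T (φ j) _
  simp only [heq]
  refine tendstoUniformlyOn_partialPairing (isOpen_extChartAt_target x) T hL hLU k v _ hadm ?_
  intro L' hL' hL'U m w
  have h1 := h (x, 0) L' hL' (by rw [extChartAt_prod, extChartAt_real]; exact hL'U) m w
  simpa only [local_rep_eq] using h1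

/-- The tensor product `v ⊗ T` of distributions on `M` and on `ℝ`,
`⟨v ⊗ T, φ⟩ = ⟨v, p ↦ ⟨T, φ (p, ·)⟩⟩`. -/
noncomputable def tensor (v : distributions I M) (T : distributions 𝓘(ℝ, ℝ) ℝ) :
    distributions (I.prod 𝓘(ℝ, ℝ)) (M × ℝ) :=
  ⟨{ toFun := fun φ => v.1 (partialApply T φ)
     map_add' := fun φ ψ => by
      rw [← map_add]
      congr 1
      ext p
      exact T.1.map_add (slice φ p) (slice ψ p)
     map_smul' := fun c φ => by
      rw [RingHom.id_apply, ← map_smul]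
      congr 1
      ext p
      exact T.1.map_smul c (slice φ p) },
   fun φ hφ => v.2 _ (partialApply_tendstoZero T hφ)⟩

variable (I M)

/-- The space `C^{-∞}(M) ⊗ T` of the distributions `v ⊗ T` on `M × ℝ`, with `v ∈ C^{-∞}(M)`. -/
noncomputable def tensorSpace (T : distributions 𝓘(ℝ, ℝ) ℝ) :
    Submodule ℂ (distributions (I.prod 𝓘(ℝ, ℝ)) (M × ℝ)) where
  carrier := {w | ∃ v : distributions I M, w = tensor v T}
  add_mem' := by
    rintro _ _ ⟨v, rfl⟩ ⟨v', rfl⟩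
    exact ⟨v + v', rfl⟩
  zero_mem' := ⟨0, rfl⟩
  smul_mem' := by
    rintro c _ ⟨v, rfl⟩
    exact ⟨c • v, rfl⟩

end TensorManifold

end HomDist

namespace HomDist

/-! ### Operations on test functions -/

section Operations

theorem exists_cutoff (R : ℝ) :
    ∃ κ : testFunctions 𝓘(ℝ, ℝ) ℝ, ∀ t, |t| ≤ R → (κ : ℝ → ℂ) t = 1 := by
  let b : ContDiffBump (0 : ℝ) := ⟨|R| + 1, |R| + 2, by positivity, by linarith⟩
  refine ⟨⟨fun t => ((b t : ℝ) : ℂ), mem_testFunctions_real (R := |R| + 2)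
    (Complex.ofRealCLM.contDiff.comp b.contDiff) fun t ht => ?_⟩, fun t ht => ?_⟩
  · have : b t = 0 := b.zero_of_le_dist (by simpa using ht.le)
    simp [this]
  · have : b t = 1 := b.one_of_mem_closedBall (by
      simpa using ht.trans ((le_abs_self R).trans (by linarith)))
    simp [this]

variable {E : Type*} [NormedAddCommGroup E] [NormedSpace ℝ E]
  {H : Type*} [TopologicalSpace H] {I : ModelWithCorners ℝ E H}
  {M : Type*} [TopologicalSpace M] [ChartedSpace H M]

theorem contMDiff_mul_complex {f g : M → ℂ} (hf : ContMDiff I 𝓘(ℝ, ℂ) ∞ f)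
    (hg : ContMDiff I 𝓘(ℝ, ℂ) ∞ g) : ContMDiff I 𝓘(ℝ, ℂ) ∞ fun x => f x * g x :=
  (ContDiff.contMDiff (contDiff_mul (𝕜 := ℝ) (𝔸 := ℂ))).comp (hf.prodMk_space hg)

section Hausdorff

variable [T2Space M]

/-- The product `φ ⊗ χ` of test functions on `M` and on `ℝ`. -/
noncomputable def outer (φ : testFunctions I M) (χ : testFunctions 𝓘(ℝ, ℝ) ℝ) :
    testFunctions (I.prod 𝓘(ℝ, ℝ)) (M × ℝ) :=
  ⟨fun x => (φ : M → ℂ) x.1 * (χ : ℝ → ℂ) x.2,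
    contMDiff_mul_complex (φ.2.1.comp contMDiff_fst) (χ.2.1.comp contMDiff_snd), by
      refine HasCompactSupport.intro (φ.2.2.isCompact.prod χ.2.2.isCompact) fun x hx => ?_
      by_cases h : x.1 ∈ tsupport (φ : M → ℂ)
      · rw [image_eq_zero_of_notMem_tsupport fun h' => hx ⟨h, h'⟩, mul_zero]
      · rw [image_eq_zero_of_notMem_tsupport h, zero_mul]⟩

theorem slice_outer (φ : testFunctions I M) (χ : testFunctions 𝓘(ℝ, ℝ) ℝ) (p : M) :
    slice (outer φ χ) p = (φ : M → ℂ) p • χ := rfl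

/-- The test function `((p, t), s) ↦ κ t * κ s * Ψ (p, g (t, s))`. -/
noncomputable def reparam (κ : testFunctions 𝓘(ℝ, ℝ) ℝ) {g : ℝ × ℝ → ℝ} (hg : ContDiff ℝ ∞ g)
    (Ψ : testFunctions (I.prod 𝓘(ℝ, ℝ)) (M × ℝ)) :
    testFunctions ((I.prod 𝓘(ℝ, ℝ)).prod 𝓘(ℝ, ℝ)) ((M × ℝ) × ℝ) :=
  ⟨fun x => (κ : ℝ → ℂ) x.1.2 * (κ : ℝ → ℂ) x.2 * (Ψ : M × ℝ → ℂ) (x.1.1, g (x.1.2, x.2)), by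
    have h1 : ContMDiff ((I.prod 𝓘(ℝ, ℝ)).prod 𝓘(ℝ, ℝ)) 𝓘(ℝ, ℝ) ∞
        (fun x : (M × ℝ) × ℝ => x.1.2) := contMDiff_snd.comp contMDiff_fst
    have h2 : ContMDiff ((I.prod 𝓘(ℝ, ℝ)).prod 𝓘(ℝ, ℝ)) 𝓘(ℝ, ℝ) ∞
        (fun x : (M × ℝ) × ℝ => x.2) := contMDiff_snd
    have h3 : ContMDiff ((I.prod 𝓘(ℝ, ℝ)).prod 𝓘(ℝ, ℝ)) I ∞
        (fun x : (M × ℝ) × ℝ => x.1.1) := contMDiff_fst.comp contMDiff_fst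
    have h4 : ContMDiff ((I.prod 𝓘(ℝ, ℝ)).prod 𝓘(ℝ, ℝ)) 𝓘(ℝ, ℝ) ∞
        (fun x : (M × ℝ) × ℝ => g (x.1.2, x.2)) :=
      hg.contMDiff.comp (h1.prodMk_space h2)
    exact contMDiff_mul_complex (contMDiff_mul_complex (κ.2.1.comp h1) (κ.2.1.comp h2))
      (Ψ.2.1.comp (h3.prodMk h4)), by
    refine HasCompactSupport.intro (((Ψ.2.2.isCompact.image continuous_fst).prod
      κ.2.2.isCompact).prod κ.2.2.isCompact) fun x hx => ?_
    by_contra hne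
    simp only [mul_eq_zero, not_or] at hne
    exact hx ⟨⟨⟨_, subset_tsupport _ hne.2, rfl⟩, subset_tsupport _ hne.1.1⟩,
      subset_tsupport _ hne.1.2⟩⟩

end Hausdorff

/-- The product of a test function on `M × ℝ` with `t`. -/
noncomputable def mulTime (Φ : testFunctions (I.prod 𝓘(ℝ, ℝ)) (M × ℝ)) :
    testFunctions (I.prod 𝓘(ℝ, ℝ)) (M × ℝ) :=
  ⟨fun x => (x.2 : ℂ) * (Φ : M × ℝ → ℂ) x,
    contMDiff_mul_complex (Complex.ofRealCLM.contDiff.contMDiff.comp contMDiff_snd) Φ.2.1,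
    Φ.2.2.mul_left⟩

theorem exists_bound_time (Φ : testFunctions (I.prod 𝓘(ℝ, ℝ)) (M × ℝ)) :
    ∃ R : ℝ, ∀ p t, R < |t| → (Φ : M × ℝ → ℂ) (p, t) = 0 := by
  obtain ⟨R, hR⟩ := exists_bound_support_prod (I := I) Φ.2.2.isCompact
  exact ⟨R, hR Φ subset_rfl⟩

theorem contDiff_slice (Φ : testFunctions (I.prod 𝓘(ℝ, ℝ)) (M × ℝ)) (p : M) :
    ContDiff ℝ ∞ fun t => (Φ : M × ℝ → ℂ) (p, t) :=
  testFunctions_real_contDiff (slice Φ p)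

variable [FiniteDimensional ℝ E] [I.Boundaryless] [IsManifold I ∞ M] [T2Space M]

theorem deriv_slice_mem (Φ : testFunctions (I.prod 𝓘(ℝ, ℝ)) (M × ℝ)) :
    (fun x : M × ℝ => deriv (fun t => (Φ : M × ℝ → ℂ) (x.1, t)) x.2) ∈
      testFunctions (I.prod 𝓘(ℝ, ℝ)) (M × ℝ) := by
  obtain ⟨R, hR⟩ := exists_bound_time Φ
  obtain ⟨κ, hκ⟩ := exists_cutoff (|R| + 1)
  have hg : ContDiff ℝ ∞ fun x : ℝ × ℝ => x.1 + x.2 := by fun_prop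
  convert (-partialApply (diracDeriv 1) (reparam κ hg Φ)).2 using 1
  ext ⟨p, t⟩
  have h0 : (slice (reparam κ hg Φ) (p, t) : ℝ → ℂ) =ᶠ[𝓝 0]
      fun s => (κ : ℝ → ℂ) t * (Φ : M × ℝ → ℂ) (p, t + s) := by
    filter_upwards [Metric.closedBall_mem_nhds (0 : ℝ) one_pos] with s hs
    have hs' : |s| ≤ 1 := by simpa using hs
    change (κ : ℝ → ℂ) t * (κ : ℝ → ℂ) s * (Φ : M × ℝ → ℂ) (p, t + s) = _
    rw [hκ s (hs'.trans (by linarith [abs_nonneg R])), mul_one]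
  have h1 : ((-partialApply (diracDeriv 1) (reparam κ hg Φ) :
      testFunctions (I.prod 𝓘(ℝ, ℝ)) (M × ℝ)) : M × ℝ → ℂ) (p, t)
      = deriv (slice (reparam κ hg Φ) (p, t) : ℝ → ℂ) 0 := by
    change -((-1) ^ 1 * iteratedDeriv 1 (slice (reparam κ hg Φ) (p, t) : ℝ → ℂ) 0) = _
    rw [iteratedDeriv_one]
    ring
  rw [h1, h0.deriv_eq, deriv_const_mul_field,
    deriv_comp_const_add (f := fun s => (Φ : M × ℝ → ℂ) (p, s)), add_zero]
  change deriv (fun t => (Φ : M × ℝ → ℂ) (p, t)) t = _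
  by_cases ht : |t| ≤ |R|
  · rw [hκ t (by linarith), one_mul]
  · have : deriv (fun t => (Φ : M × ℝ → ℂ) (p, t)) t = 0 := by
      rw [← iteratedDeriv_one]
      exact iteratedDeriv_eq_zero_of_support (hR p) 1 t
        ((le_abs_self R).trans_lt (not_le.1 ht))
    simp [this]

/-- The partial derivative `∂_t Φ` of a test function on `M × ℝ`. -/
noncomputable def timeDeriv (Φ : testFunctions (I.prod 𝓘(ℝ, ℝ)) (M × ℝ)) :
    testFunctions (I.prod 𝓘(ℝ, ℝ)) (M × ℝ) :=
  ⟨fun x => deriv (fun t => (Φ : M × ℝ → ℂ) (x.1, t)) x.2, deriv_slice_mem Φ⟩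

theorem timeDeriv_iterate (k : ℕ) (Φ : testFunctions (I.prod 𝓘(ℝ, ℝ)) (M × ℝ)) (p : M) (t : ℝ) :
    (timeDeriv^[k] Φ : M × ℝ → ℂ) (p, t)
      = iteratedDeriv k (fun t => (Φ : M × ℝ → ℂ) (p, t)) t := by
  induction k generalizing t with
  | zero => simp
  | succ k ih =>
    rw [Function.iterate_succ_apply', iteratedDeriv_succ]
    change deriv (fun t => (timeDeriv^[k] Φ : M × ℝ → ℂ) (p, t)) t = _
    congr 1
    ext t
    exact ih t

theorem hasDerivAt_timeDeriv (Φ : testFunctions (I.prod 𝓘(ℝ, ℝ)) (M × ℝ)) (p : M) (t : ℝ) :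
    HasDerivAt (fun t => (Φ : M × ℝ → ℂ) (p, t)) ((timeDeriv Φ : M × ℝ → ℂ) (p, t)) t :=
  ((contDiff_slice Φ p).differentiable (by simp) t).hasDerivAt

variable (a : ℂ) in
/-- The operator `t ∂_t + a` on the test functions on `M × ℝ`. -/
noncomputable def eulerOp (Φ : testFunctions (I.prod 𝓘(ℝ, ℝ)) (M × ℝ)) :
    testFunctions (I.prod 𝓘(ℝ, ℝ)) (M × ℝ) := mulTime (timeDeriv Φ) + a • Φ

/-- If `∂_t Ψ` is in the range of `t ∂_t + a + 1` and `a ≠ 0`, then `Ψ` is in the range of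
`t ∂_t + a`. -/
theorem exists_eulerOp_of_timeDeriv {a : ℂ} (ha : a ≠ 0)
    {Ψ : testFunctions (I.prod 𝓘(ℝ, ℝ)) (M × ℝ)} (h : ∃ Θ, eulerOp (a + 1) Θ = timeDeriv Ψ) :
    ∃ Θ, eulerOp a Θ = Ψ := by
  obtain ⟨Θ, hΘ⟩ := h
  have hΘ' : ∀ (p : M) (t : ℝ),
      (t : ℂ) * (timeDeriv Θ : M × ℝ → ℂ) (p, t) + (a + 1) * (Θ : M × ℝ → ℂ) (p, t)
      = (timeDeriv Ψ : M × ℝ → ℂ) (p, t) := fun p t =>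
    congrFun (congrArg (fun f : testFunctions (I.prod 𝓘(ℝ, ℝ)) (M × ℝ) => (f : M × ℝ → ℂ)) hΘ)
      (p, t)
  have key : timeDeriv (a⁻¹ • (Ψ - mulTime Θ)) = Θ := by
    ext ⟨p, t⟩
    have h1 : HasDerivAt (fun t : ℝ => a⁻¹ * ((Ψ : M × ℝ → ℂ) (p, t) -
          (t : ℂ) * (Θ : M × ℝ → ℂ) (p, t)))
        (a⁻¹ * ((timeDeriv Ψ : M × ℝ → ℂ) (p, t) - (1 * (Θ : M × ℝ → ℂ) (p, t) +
          (t : ℂ) * (timeDeriv Θ : M × ℝ → ℂ) (p, t)))) t :=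
      ((hasDerivAt_timeDeriv Ψ p t).sub
        ((hasDerivAt_id t).ofReal_comp.mul (hasDerivAt_timeDeriv Θ p t))).const_mul _
    refine h1.deriv.trans ?_
    rw [← hΘ' p t]
    field_simp
    ring
  refine ⟨a⁻¹ • (Ψ - mulTime Θ), ?_⟩
  rw [eulerOp, key, smul_inv_smul₀ ha, add_sub_cancel]

theorem exists_eulerOp_of_iterate_timeDeriv (k : ℕ) : ∀ {a : ℂ}, (∀ j < k, a + j ≠ 0) →
    ∀ {Ψ : testFunctions (I.prod 𝓘(ℝ, ℝ)) (M × ℝ)},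
    (∃ Θ, eulerOp (a + k) Θ = timeDeriv^[k] Ψ) → ∃ Θ, eulerOp a Θ = Ψ := by
  induction k with
  | zero => intro a _ Ψ h; simpa using h
  | succ k ih =>
    intro a ha Ψ h
    refine exists_eulerOp_of_timeDeriv (by simpa using ha 0 (Nat.succ_pos k))
      (ih (fun j hj => ?_) ?_)
    · have := ha (j + 1) (by omega)
      push_cast at this
      rwa [add_assoc, add_comm 1]
    · rw [Function.iterate_succ_apply] at h
      push_cast at h
      rwa [add_assoc, add_comm 1]

end Operations

/-! ### Convergence of products and of sections -/

section Calculus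

variable {E : Type*} [NormedAddCommGroup E] [NormedSpace ℝ E] {U : Set E}

theorem dirDeriv_outer (hU : IsOpen U) {f : E → ℂ} (hf : ContDiffOn ℝ ∞ f U) {χ : ℝ → ℂ}
    (hχ : ContDiff ℝ ∞ χ) (w : E × ℝ) :
    EqOn (dirDeriv w fun z : E × ℝ => f z.1 * χ z.2)
      (fun z => dirDeriv w.1 f z.1 * χ z.2 + f z.1 * ((w.2 : ℂ) * deriv χ z.2)) (U ×ˢ univ) := by
  rintro ⟨y, t⟩ ⟨hy, -⟩
  have h1 : HasFDerivAt f (fderiv ℝ f y) y :=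
    ((hf.contDiffAt (hU.mem_nhds hy)).differentiableAt (by simp)).hasFDerivAt
  have h2 : HasFDerivAt χ (fderiv ℝ χ t) t := (hχ.differentiable (by simp) t).hasFDerivAt
  have h1' : HasFDerivAt (f ∘ Prod.fst) ((fderiv ℝ f y).comp (ContinuousLinearMap.fst ℝ E ℝ))
      (y, t) := HasFDerivAt.comp (y, t) h1 hasFDerivAt_fst
  have h2' : HasFDerivAt (χ ∘ Prod.snd) ((fderiv ℝ χ t).comp (ContinuousLinearMap.snd ℝ E ℝ))
      (y, t) := HasFDerivAt.comp (y, t) h2 hasFDerivAt_snd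
  have h3 := h1'.mul h2'
  have h4 : fderiv ℝ χ t w.2 = (w.2 : ℂ) * deriv χ t := by
    rw [fderiv_eq_smul_deriv, Complex.real_smul]
  change fderiv ℝ ((f ∘ Prod.fst) * (χ ∘ Prod.snd)) (y, t) w = _
  rw [h3.fderiv]
  simp [h4, dirDeriv]
  ring

theorem contDiffOn_outer {f : E → ℂ} (hf : ContDiffOn ℝ ∞ f U) {χ : ℝ → ℂ}
    (hχ : ContDiff ℝ ∞ χ) :
    ContDiffOn ℝ ∞ (fun z : E × ℝ => f z.1 * χ z.2) (U ×ˢ univ) :=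
  (hf.comp contDiffOn_fst fun _ hz => hz.1).mul (hχ.comp contDiff_snd).contDiffOn

theorem iteratedFDeriv_congr_of_isOpen {Ω : Set E} (hΩ : IsOpen Ω) {F G : E → ℂ}
    (h : EqOn F G Ω) (k : ℕ) : EqOn (iteratedFDeriv ℝ k F) (iteratedFDeriv ℝ k G) Ω :=
  fun _ hz => (Filter.EventuallyEq.iteratedFDeriv ℝ
    (h.eventuallyEq_of_mem (hΩ.mem_nhds hz)) k).eq_of_nhds

theorem tendstoUniformlyOn_iteratedFDeriv_outer (hU : IsOpen U) {L : Set E} {L₂ : Set ℝ}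
    (hLU : L ⊆ U) (hL₂ : IsCompact L₂) (k : ℕ) :
    ∀ (w : Fin k → E × ℝ) (f : ℕ → E → ℂ) (χ : ℝ → ℂ), (∀ j, ContDiffOn ℝ ∞ (f j) U) →
      ContDiff ℝ ∞ χ →
      (∀ (m : ℕ) (v : Fin m → E),
        TendstoUniformlyOn (fun j y => iteratedFDeriv ℝ m (f j) y v) (fun _ => 0) atTop L) →
      TendstoUniformlyOn
        (fun j z => iteratedFDeriv ℝ k (fun z : E × ℝ => f j z.1 * χ z.2) z w)
        (fun _ => 0) atTop (L ×ˢ L₂) := by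
  have hΩ : IsOpen (U ×ˢ (univ : Set ℝ)) := hU.prod isOpen_univ
  induction k with
  | zero =>
    intro w f χ _ hχ hconv
    obtain ⟨C, hC⟩ := hL₂.exists_bound_of_continuousOn hχ.continuous.continuousOn
    have h0 := Metric.tendstoUniformlyOn_iff.1 (hconv 0 (fun _ => 0))
    rw [Metric.tendstoUniformlyOn_iff]
    intro ε hε
    filter_upwards [h0 (ε / (|C| + 1)) (by positivity)] with j hj z hz
    have h1 := hj z.1 hz.1
    have h2 := (hC z.2 hz.2).trans (le_abs_self C)
    simp only [iteratedFDeriv_zero_apply, dist_zero_left] at h1 ⊢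
    rw [lt_div_iff₀ (by positivity)] at h1
    rw [norm_mul]
    nlinarith [norm_nonneg (f j z.1)]
  | succ k ih =>
    intro w f χ hf hχ hconv
    have hχ' : ContDiff ℝ ∞ fun t => ((w (Fin.last k)).2 : ℂ) * deriv χ t :=
      contDiff_const.mul (contDiff_infty_iff_deriv.1 hχ).2
    have h1 := ih (Fin.init w) (fun j => dirDeriv (w (Fin.last k)).1 (f j)) χ
      (fun j => dirDeriv_smooth hU _ (hf j)) hχ fun m v =>
        (hconv (m + 1) (Fin.snoc (α := fun _ => E) v (w (Fin.last k)).1)).congr <|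
          Eventually.of_forall fun j y hy =>
            (iteratedFDeriv_dirDeriv hU _ (hf j) m v (hLU hy)).symm
    have h2 := ih (Fin.init w) f _ hf hχ' hconv
    have h3 := h1.add h2
    simp only [Pi.add_def, add_zero] at h3
    refine h3.congr (Eventually.of_forall fun j z hz => ?_)
    have hz' : z ∈ U ×ˢ (univ : Set ℝ) := ⟨hLU hz.1, mem_univ _⟩
    have h4 := iteratedFDeriv_dirDeriv hΩ (w (Fin.last k)) (contDiffOn_outer (hf j) hχ) k
      (Fin.init w) hz'
    rw [Fin.snoc_init_self] at h4
    dsimp only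
    rw [← h4, iteratedFDeriv_congr_of_isOpen hΩ (dirDeriv_outer hU (hf j) hχ _) k hz']
    have cd : ∀ {F : E × ℝ → ℂ}, ContDiffOn ℝ ∞ F (U ×ˢ univ) → ContDiffAt ℝ k F z := fun hF =>
      (hF.contDiffAt (hΩ.mem_nhds hz')).of_le (by exact_mod_cast le_top)
    have h5 := iteratedFDeriv_add_apply
      (cd (contDiffOn_outer (dirDeriv_smooth hU (w (Fin.last k)).1 (hf j)) hχ))
      (cd (contDiffOn_outer (hf j) hχ'))
    exact (congrArg (fun A => A (Fin.init w)) h5).symm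

theorem exists_bound_iteratedFDeriv_section (hU : IsOpen U) {L : Set E} (hL : IsCompact L)
    (hLU : L ⊆ U) (k : ℕ) :
    ∀ (v : Fin k → E) (F : E × ℝ → ℂ), ContDiffOn ℝ ∞ F (U ×ˢ univ) →
      ∃ C, ∀ y ∈ L, ∀ h : ℝ, |h| ≤ 1 → ‖iteratedFDeriv ℝ k (fun y => F (y, h)) y v‖ ≤ C := by
  have hΩ : IsOpen (U ×ˢ (univ : Set ℝ)) := hU.prod isOpen_univ
  induction k with
  | zero =>
    intro v F hF
    obtain ⟨C, hC⟩ :=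
      (hL.prod (isCompact_Icc (a := (-1 : ℝ)) (b := 1))).exists_bound_of_continuousOn
      (hF.continuousOn.mono (prod_mono hLU (subset_univ _)))
    exact ⟨C, fun y hy h hh => hC (y, h) ⟨hy, abs_le.1 hh⟩⟩
  | succ k ih =>
    intro v F hF
    obtain ⟨C, hC⟩ := ih (Fin.init v) (dirDeriv (v (Fin.last k), 0) F) (dirDeriv_smooth hΩ _ hF)
    refine ⟨C, fun y hy h hh => ?_⟩
    have hs : ContDiffOn ℝ ∞ (fun y => F (y, h)) U :=
      hF.comp (contDiff_prodMk_left h).contDiffOn fun _ hy => ⟨hy, mem_univ _⟩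
    have h1 : EqOn (dirDeriv (v (Fin.last k)) fun y => F (y, h))
        (fun y => dirDeriv (v (Fin.last k), 0) F (y, h)) U := fun y hy => by
      have hd : DifferentiableAt ℝ F (y, h) :=
        (hF.contDiffAt (hΩ.mem_nhds ⟨hy, mem_univ h⟩)).differentiableAt (by simp)
      have h2 : HasFDerivAt (F ∘ fun y => (y, h))
          ((fderiv ℝ F (y, h)).comp (ContinuousLinearMap.inl ℝ E ℝ)) y :=
        HasFDerivAt.comp y hd.hasFDerivAt (hasFDerivAt_prodMk_left y h)
      change fderiv ℝ (F ∘ fun y => (y, h)) y _ = _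
      rw [h2.fderiv]
      simp [dirDeriv]
    have h2 := iteratedFDeriv_dirDeriv hU (v (Fin.last k)) hs k (Fin.init v) (hLU hy)
    rw [Fin.snoc_init_self] at h2
    rw [← h2, iteratedFDeriv_congr_of_isOpen hU h1 k (hLU hy)]
    exact hC y hy h hh

end Calculus

section Manifold

variable {E : Type*} [NormedAddCommGroup E] [NormedSpace ℝ E]
  {H : Type*} [TopologicalSpace H] {I : ModelWithCorners ℝ E H}
  {M : Type*} [TopologicalSpace M] [ChartedSpace H M]

/-- The restriction `p ↦ D (p, h)` of a test function on `M × ℝ`. -/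
noncomputable def timeSection [T2Space M] (D : testFunctions (I.prod 𝓘(ℝ, ℝ)) (M × ℝ)) (h : ℝ) :
    testFunctions I M :=
  ⟨fun p => (D : M × ℝ → ℂ) (p, h), D.2.1.comp (contMDiff_id.prodMk contMDiff_const),
    HasCompactSupport.intro (D.2.2.isCompact.image continuous_fst) fun p hp => by
      by_contra hne
      exact hp ⟨(p, h), subset_tsupport _ hne, rfl⟩⟩

theorem contDiffOn_chart [IsManifold I ∞ M] (φ : testFunctions I M) (x : M) :
    ContDiffOn ℝ ∞ ((φ : M → ℂ) ∘ (extChartAt I x).symm) (extChartAt I x).target := by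
  rw [← contMDiffOn_iff_contDiffOn]
  exact φ.2.1.comp_contMDiffOn (contMDiffOn_extChartAt_symm x)

variable [I.Boundaryless] [IsManifold I ∞ M] [T2Space M]

theorem tendstoZero_outer {φ : ℕ → testFunctions I M} (hφ : TendstoZero φ)
    (χ : testFunctions 𝓘(ℝ, ℝ) ℝ) : TendstoZero fun j => outer (φ j) χ := by
  obtain ⟨⟨K, hK, hKs⟩, h⟩ := hφ
  refine ⟨⟨K ×ˢ tsupport (χ : ℝ → ℂ), hK.prod χ.2.2.isCompact, fun j => ?_⟩, ?_⟩
  · refine closure_minimal (fun x hx => ?_) (hK.isClosed.prod (isClosed_tsupport _))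
    have hx' : (φ j : M → ℂ) x.1 * (χ : ℝ → ℂ) x.2 ≠ 0 := hx
    exact ⟨hKs j (subset_tsupport _ (left_ne_zero_of_mul hx')),
      subset_tsupport _ (right_ne_zero_of_mul hx')⟩
  · rintro ⟨x, t⟩ L hL hLU k w
    have htarget : (extChartAt (I.prod 𝓘(ℝ, ℝ)) (x, t)).target
        = (extChartAt I x).target ×ˢ univ := by
      rw [extChartAt_prod, extChartAt_real]
      rfl
    rw [htarget] at hLU
    have hL₁ : Prod.fst '' L ⊆ (extChartAt I x).target := by
      rintro _ ⟨z, hz, rfl⟩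
      exact (hLU hz).1
    have h1 := tendstoUniformlyOn_iteratedFDeriv_outer (isOpen_extChartAt_target x) hL₁
      (hL.image continuous_snd) k w (fun j => (φ j : M → ℂ) ∘ (extChartAt I x).symm)
      (χ : ℝ → ℂ) (fun j => contDiffOn_chart (φ j) x) (testFunctions_real_contDiff χ)
      (fun m v => h x _ (hL.image continuous_fst) hL₁ m v)
    have h2 : ∀ j, (outer (φ j) χ : M × ℝ → ℂ) ∘ (extChartAt (I.prod 𝓘(ℝ, ℝ)) (x, t)).symm
        = fun z : E × ℝ => ((φ j : M → ℂ) ∘ (extChartAt I x).symm) z.1 * (χ : ℝ → ℂ) z.2 := by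
      intro j
      rw [extChartAt_prod, extChartAt_real]
      rfl
    simp only [h2]
    exact h1.mono fun z hz => ⟨⟨z, hz, rfl⟩, ⟨z, hz, rfl⟩⟩

theorem tendstoZero_smul_timeSection (D : testFunctions (I.prod 𝓘(ℝ, ℝ)) (M × ℝ)) {h : ℕ → ℝ}
    (hh : Tendsto h atTop (𝓝 0)) (hh1 : ∀ j, |h j| ≤ 1) :
    TendstoZero fun j => (h j : ℂ) • timeSection D (h j) := by
  refine ⟨⟨Prod.fst '' tsupport (D : M × ℝ → ℂ), D.2.2.isCompact.image continuous_fst,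
    fun j => ?_⟩, fun x L hL hLU k v => ?_⟩
  · refine closure_minimal (fun p hp => ?_) (D.2.2.isCompact.image continuous_fst).isClosed
    have hp' : (h j : ℂ) * (D : M × ℝ → ℂ) (p, h j) ≠ 0 := hp
    exact ⟨(p, h j), subset_tsupport _ (right_ne_zero_of_mul hp'), rfl⟩
  · have hU := isOpen_extChartAt_target (I := I) x
    have hD : ContDiffOn ℝ ∞ (local_rep x D) ((extChartAt I x).target ×ˢ univ) := by
      have h1 := contDiffOn_chart D (x, (0 : ℝ))
      rwa [local_rep_eq, extChartAt_prod, extChartAt_real] at h1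
    obtain ⟨C, hC⟩ := exists_bound_iteratedFDeriv_section hU hL hLU k v (local_rep x D) hD
    rw [Metric.tendstoUniformlyOn_iff]
    intro ε hε
    have hh' := (Metric.tendsto_nhds.1 hh) (ε / (|C| + 1)) (by positivity)
    filter_upwards [hh'] with j hj y hy
    have hs : ContDiffOn ℝ ∞ (fun y => local_rep x D (y, h j)) (extChartAt I x).target :=
      contDiffOn_chart (timeSection D (h j)) x
    have h2 : iteratedFDeriv ℝ k (((h j : ℂ) • timeSection D (h j) : testFunctions I M) ∘
        (extChartAt I x).symm) y v
        = (h j : ℂ) * iteratedFDeriv ℝ k (fun y => local_rep x D (y, h j)) y v := by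
      have h3 := iteratedFDeriv_const_smul_apply (𝕜 := ℝ) (i := k) (x := y) (a := (h j : ℂ))
        (f := fun y => local_rep x D (y, h j))
        ((hs.contDiffAt (hU.mem_nhds (hLU hy))).of_le (by exact_mod_cast le_top))
      exact congrArg (fun A => A v) h3
    rw [h2, dist_zero_left, norm_mul, Complex.norm_real, Real.norm_eq_abs]
    rw [dist_zero_right, Real.norm_eq_abs, lt_div_iff₀ (by positivity)] at hj
    have := (hC y hy (h j) (hh1 j)).trans (le_abs_self C)
    nlinarith [abs_nonneg (h j)]

end Manifold

/-! ### Means over dilations and Euler's equation -/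

section Mean

theorem integrableOn_unitWeight {b : ℂ} (hb : 0 < b.re) (R : ℝ) :
    IntegrableOn ((Ioc (0 : ℝ) 1).indicator fun s : ℝ => (s : ℂ) ^ (b - 1)) (Ioc 0 R) :=
  (integrableOn_cpow (by simpa using hb) R).indicator measurableSet_Ioc

/-- The distribution `φ ↦ ∫_0^1 s^{b-1} φ(s) ds`, for `Re b > 0`. -/
noncomputable def unitMean {b : ℂ} (hb : 0 < b.re) : distributions 𝓘(ℝ, ℝ) ℝ :=
  integralDeriv _ (integrableOn_unitWeight hb) 0

theorem unitMean_apply {b : ℂ} (hb : 0 < b.re) (ψ : testFunctions 𝓘(ℝ, ℝ) ℝ) :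
    (unitMean hb).1 ψ = ∫ s in (0 : ℝ)..1, (s : ℂ) ^ (b - 1) * (ψ : ℝ → ℂ) s := by
  change ∫ s in Ioi (0 : ℝ), _ * iteratedDeriv 0 (ψ : ℝ → ℂ) s = _
  rw [intervalIntegral.integral_of_le zero_le_one, ← integral_indicator measurableSet_Ioi,
    ← integral_indicator measurableSet_Ioc]
  congr 1
  ext s
  by_cases hs : s ∈ Ioc (0 : ℝ) 1
  · simp [hs, show (0 : ℝ) < s from hs.1]
  · rw [indicator_of_notMem hs, indicator_apply]
    split_ifs
    · rw [indicator_of_notMem hs, zero_mul]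
    · rfl

variable {E : Type*} [NormedAddCommGroup E] [NormedSpace ℝ E]
  {H : Type*} [TopologicalSpace H] {I : ModelWithCorners ℝ E H}
  {M : Type*} [TopologicalSpace M] [ChartedSpace H M]
  [FiniteDimensional ℝ E] [I.Boundaryless] [IsManifold I ∞ M] [T2Space M]

/-- Up to a cut-off `κ (t)`, equal to `1` for `|t| ≤ R`, the mean `∫_0^1 s^{b-1} Ψ(p, ts) ds` is a
test function on `M × ℝ`. -/
theorem exists_scaleMean {b : ℂ} (hb : 0 < b.re) (R : ℝ)
    (Ψ : testFunctions (I.prod 𝓘(ℝ, ℝ)) (M × ℝ)) :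
    ∃ (κ : ℝ → ℂ) (Θ : testFunctions (I.prod 𝓘(ℝ, ℝ)) (M × ℝ)), (∀ t, |t| ≤ R → κ t = 1) ∧
      ∀ p t, (Θ : M × ℝ → ℂ) (p, t)
        = κ t * ∫ s in (0 : ℝ)..1, (s : ℂ) ^ (b - 1) * (Ψ : M × ℝ → ℂ) (p, t * s) := by
  obtain ⟨κ, hκ⟩ := exists_cutoff (max R 1)
  refine ⟨κ, partialApply (unitMean hb) (reparam κ (g := fun x => x.1 * x.2) (by fun_prop) Ψ),
    fun t ht => hκ t (ht.trans (le_max_left _ _)), fun p t => ?_⟩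
  change (unitMean hb).1 (slice _ (p, t)) = _
  rw [unitMean_apply, ← intervalIntegral.integral_const_mul]
  refine intervalIntegral.integral_congr fun s hs => ?_
  rw [uIcc_of_le zero_le_one] at hs
  change (s : ℂ) ^ (b - 1) * ((κ : ℝ → ℂ) t * (κ : ℝ → ℂ) s * (Ψ : M × ℝ → ℂ) (p, t * s)) = _
  rw [hκ s (by rw [abs_of_nonneg hs.1]; exact hs.2.trans (le_max_right _ _))]
  ring

theorem exists_eq_add_mul (B : testFunctions (I.prod 𝓘(ℝ, ℝ)) (M × ℝ)) :
    ∃ C : testFunctions (I.prod 𝓘(ℝ, ℝ)) (M × ℝ), ∀ p (h : ℝ), |h| ≤ 1 →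
      (B : M × ℝ → ℂ) (p, h) = (B : M × ℝ → ℂ) (p, 0) + h * (C : M × ℝ → ℂ) (p, h) := by
  obtain ⟨κ, C, hκ, hC⟩ := exists_scaleMean (b := 1) (by simp) 1 (timeDeriv B)
  refine ⟨C, fun p h hh => ?_⟩
  have h1 : ∀ s ∈ uIcc (0 : ℝ) 1, HasDerivAt (fun s => (B : M × ℝ → ℂ) (p, h * s))
      ((h : ℂ) * (timeDeriv B : M × ℝ → ℂ) (p, h * s)) s := fun s _ => by
    have h2 := (hasDerivAt_timeDeriv B p (h * s)).scomp s ((hasDerivAt_id s).const_mul h)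
    simpa [Function.comp_def] using h2
  have hc : Continuous fun s : ℝ => (h : ℂ) * (timeDeriv B : M × ℝ → ℂ) (p, h * s) :=
    continuous_const.mul ((contDiff_slice (timeDeriv B) p).continuous.comp
      (continuous_const.mul continuous_id))
  have h3 := intervalIntegral.integral_eq_sub_of_hasDerivAt h1 (hc.intervalIntegrable _ _)
  rw [hC, hκ h hh, one_mul]
  simp only [sub_self, Complex.cpow_zero, one_mul]
  rw [← intervalIntegral.integral_const_mul, h3]
  simp

theorem tendsto_difference_quotient (u : distributions I M)
    (B : testFunctions (I.prod 𝓘(ℝ, ℝ)) (M × ℝ)) {h : ℕ → ℝ} (hh : Tendsto h atTop (𝓝 0))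
    (hh1 : ∀ j, |h j| ≤ 1) (hh0 : ∀ j, h j ≠ 0) :
    Tendsto (fun j => (h j : ℂ)⁻¹ * (u.1 (timeSection B (h j)) - u.1 (timeSection B 0))) atTop
      (𝓝 (u.1 (timeSection (timeDeriv B) 0))) := by
  obtain ⟨C, hC⟩ := exists_eq_add_mul B
  obtain ⟨D, hD⟩ := exists_eq_add_mul C
  have hC0 : timeSection (timeDeriv B) 0 = timeSection C 0 := by
    ext p
    have h1 : HasDerivAt (fun t : ℝ => (B : M × ℝ → ℂ) (p, 0) + t * (C : M × ℝ → ℂ) (p, t))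
        (((1 : ℝ) : ℂ) * (C : M × ℝ → ℂ) (p, 0) + ((0 : ℝ) : ℂ) * (timeDeriv C : M × ℝ → ℂ) (p, 0))
        0 :=
      ((hasDerivAt_id (0 : ℝ)).ofReal_comp.mul (hasDerivAt_timeDeriv C p 0)).const_add _
    have h2 : (fun t => (B : M × ℝ → ℂ) (p, t)) =ᶠ[𝓝 0]
        fun t : ℝ => (B : M × ℝ → ℂ) (p, 0) + t * (C : M × ℝ → ℂ) (p, t) := by
      filter_upwards [Metric.closedBall_mem_nhds (0 : ℝ) one_pos] with t ht
      exact hC p t (by simpa using ht)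
    exact (h1.congr_of_eventuallyEq h2).deriv.trans (by simp [timeSection])
  have hq : ∀ j, (h j : ℂ)⁻¹ * (u.1 (timeSection B (h j)) - u.1 (timeSection B 0))
      = u.1 (timeSection C 0) + u.1 ((h j : ℂ) • timeSection D (h j)) := by
    intro j
    have hj : (h j : ℂ) ≠ 0 := by exact_mod_cast hh0 j
    rw [← map_sub, ← smul_eq_mul, ← map_smul, ← map_add]
    congr 1
    ext p
    change (h j : ℂ)⁻¹ * ((B : M × ℝ → ℂ) (p, h j) - (B : M × ℝ → ℂ) (p, 0))
      = (C : M × ℝ → ℂ) (p, 0) + (h j : ℂ) * (D : M × ℝ → ℂ) (p, h j)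
    rw [← hD p _ (hh1 j), hC p _ (hh1 j), add_sub_cancel_left, inv_mul_cancel_left₀ hj]
  simp only [hq, hC0]
  simpa using tendsto_const_nhds.add (u.2 _ (tendstoZero_smul_timeSection D hh hh1))

/-- Euler's equation for homogeneous distributions. -/
theorem apply_eulerOp_of_mem_homogeneous {a : ℂ}
    {u : distributions (I.prod 𝓘(ℝ, ℝ)) (M × ℝ)} (hu : u ∈ homogeneous (dilation I M) a)
    (Θ : testFunctions (I.prod 𝓘(ℝ, ℝ)) (M × ℝ)) : u.1 (eulerOp a Θ) = 0 := by
  obtain ⟨R, hR⟩ := exists_bound_time Θ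
  obtain ⟨κ, hκ⟩ := exists_cutoff (2 * |R| + 1)
  set B := reparam κ (g := fun x => (1 + x.2) * x.1) (by fun_prop) Θ with hB
  have hBval : ∀ p t (h : ℝ), |h| ≤ 1 / 2 →
      (B : (M × ℝ) × ℝ → ℂ) ((p, t), h) = (Θ : M × ℝ → ℂ) (p, (1 + h) * t) := by
    intro p t h hh
    change (κ : ℝ → ℂ) t * (κ : ℝ → ℂ) h * (Θ : M × ℝ → ℂ) (p, (1 + h) * t) = _
    have hh' := abs_le.1 hh
    rw [hκ h (by linarith [abs_nonneg R])]
    by_cases ht : |t| ≤ 2 * |R| + 1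
    · rw [hκ t ht, one_mul, one_mul]
    · have : (Θ : M × ℝ → ℂ) (p, (1 + h) * t) = 0 := by
        refine hR p _ ((le_abs_self R).trans_lt ?_)
        rw [abs_mul, abs_of_pos (show 0 < 1 + h by linarith)]
        nlinarith [abs_nonneg R, abs_nonneg t]
      rw [this, mul_zero]
  have hsec : ∀ h : ℝ, |h| ≤ 1 / 2 →
      u.1 (timeSection B h) = ((1 + h : ℝ) : ℂ) ^ (-a) * u.1 Θ := by
    intro h hh
    have hpos : 0 < 1 + h := by linarith [(abs_le.1 hh).1]
    have h1 := hu ⟨1 + h, hpos⟩⁻¹ Θ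
    have h2 : pullback (dilation I M (⟨1 + h, hpos⟩⁻¹)⁻¹) Θ = timeSection B h := by
      ext ⟨p, t⟩
      rw [inv_inv]
      exact (hBval p t h hh).symm
    rw [h2] at h1
    rw [h1]
    congr 1
    change (((1 + h)⁻¹ : ℝ) : ℂ) ^ a = _
    rw [Complex.ofReal_inv, Complex.inv_cpow _ _ (by
      rw [Complex.arg_ofReal_of_nonneg hpos.le]; exact Real.pi_pos.ne), Complex.cpow_neg]
  set h : ℕ → ℝ := fun j => 1 / 2 * (1 / ((j : ℝ) + 1)) with hh
  have hlim : Tendsto h atTop (𝓝 0) := by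
    have := (tendsto_one_div_add_atTop_nhds_zero_nat (𝕜 := ℝ)).const_mul (1 / 2)
    rwa [mul_zero] at this
  have hpos : ∀ j, 0 < h j := fun j => by positivity
  have hle : ∀ j, |h j| ≤ 1 / 2 := fun j => by
    rw [abs_of_pos (hpos j)]
    have : 1 / ((j : ℝ) + 1) ≤ 1 := by
      rw [div_le_one (by positivity)]
      linarith [Nat.cast_nonneg (α := ℝ) j]
    simp only [hh]
    linarith
  have hne : ∀ j, h j ≠ 0 := fun j => (hpos j).ne'
  have hlim1 := tendsto_difference_quotient u B hlim (fun j => (hle j).trans (by norm_num)) hne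
  have hder : HasDerivAt (fun h : ℝ => ((1 + h : ℝ) : ℂ) ^ (-a)) (-a) 0 := by
    have h1 : HasDerivAt (fun h : ℝ => ((1 + h : ℝ) : ℂ)) ((1 : ℝ) : ℂ) 0 :=
      ((hasDerivAt_id (0 : ℝ)).const_add 1).ofReal_comp
    have h2 : HasDerivAt (fun z : ℂ => z ^ (-a)) ((-a) * (((1 + 0 : ℝ) : ℂ)) ^ (-a - 1))
        ((1 + 0 : ℝ) : ℂ) := by
      simpa using (hasDerivAt_id _).cpow_const (c := -a) (x := ((1 + 0 : ℝ) : ℂ)) (f := id)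
        (by simp)
    simpa [Function.comp_def] using
      HasDerivAt.comp (0 : ℝ) (h := fun h : ℝ => ((1 + h : ℝ) : ℂ)) h2 h1
  have hlim2 : Tendsto (fun j => (h j : ℂ)⁻¹ *
      (u.1 (timeSection B (h j)) - u.1 (timeSection B 0))) atTop (𝓝 (-a * u.1 Θ)) := by
    have h1 := (hder.tendsto_slope_zero.comp (tendsto_nhdsWithin_iff.2
      ⟨hlim, Eventually.of_forall hne⟩)).mul_const (u.1 Θ)
    refine h1.congr fun j => ?_
    rw [hsec _ (hle j), hsec 0 (by norm_num)]
    simp only [Function.comp, zero_add, Complex.real_smul]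
    push_cast
    ring
  have hkey := tendsto_nhds_unique hlim1 hlim2
  have hsec0 : timeSection (timeDeriv B) 0 = mulTime (timeDeriv Θ) := by
    ext ⟨p, t⟩
    have h1 : (fun h => (B : (M × ℝ) × ℝ → ℂ) ((p, t), h)) =ᶠ[𝓝 0]
        fun h => (Θ : M × ℝ → ℂ) (p, (1 + h) * t) := by
      filter_upwards [Metric.closedBall_mem_nhds (0 : ℝ) (by norm_num : (0 : ℝ) < 1 / 2)] with h hh
      exact hBval p t h (by simpa using hh)
    have h2 : HasDerivAt (fun h : ℝ => (1 + h) * t) (1 * t) 0 :=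
      ((hasDerivAt_id (0 : ℝ)).const_add 1).mul_const t
    have h3 := HasDerivAt.scomp (0 : ℝ) (g₁ := fun t => (Θ : M × ℝ → ℂ) (p, t))
      (hasDerivAt_timeDeriv Θ p ((1 + 0) * t)) h2
    refine ((h3.congr_of_eventuallyEq h1).deriv).trans ?_
    simp [mulTime]
  rw [eulerOp, map_add, map_smul, ← hsec0, hkey, smul_eq_mul]
  ring

end Mean

/-! ### The range of the Euler operator -/

section Line

theorem cpow_mul_scaleMean {b : ℂ} {ψ : ℝ → ℂ} {t : ℝ} (ht : 0 < t) :
    (t : ℂ) ^ b * ∫ s in (0 : ℝ)..1, (s : ℂ) ^ (b - 1) * ψ (t * s)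
      = ∫ s in (0 : ℝ)..t, (s : ℂ) ^ (b - 1) * ψ s := by
  have h1 := intervalIntegral.smul_integral_comp_mul_left (a := 0) (b := 1)
    (fun s : ℝ => (s : ℂ) ^ (b - 1) * ψ s) t
  rw [mul_zero, mul_one] at h1
  have ht' : (t : ℂ) ≠ 0 := by exact_mod_cast ht.ne'
  rw [← h1, Complex.real_smul, ← intervalIntegral.integral_const_mul,
    ← intervalIntegral.integral_const_mul]
  refine intervalIntegral.integral_congr fun s hs => ?_
  rw [uIcc_of_le zero_le_one] at hs
  rw [Complex.ofReal_mul, Complex.mul_cpow_ofReal_nonneg ht.le hs.1]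
  nth_rewrite 1 [show b = b - 1 + 1 by ring]
  rw [Complex.cpow_add _ _ ht', Complex.cpow_one]
  ring

theorem intervalIntegrable_cpow_mul {b : ℂ} (hb : 0 < b.re) {ψ : ℝ → ℂ} (hψ : Continuous ψ)
    (x y : ℝ) : IntervalIntegrable (fun s : ℝ => (s : ℂ) ^ (b - 1) * ψ s) volume x y :=
  (intervalIntegral.intervalIntegrable_cpow' (by simpa using hb)).mul_continuousOn hψ.continuousOn

theorem euler_scaleMean_of_pos {b : ℂ} (hb : 0 < b.re) {ψ m : ℝ → ℂ} (hψ : Continuous ψ)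
    (hm : ∀ t, m t = ∫ s in (0 : ℝ)..1, (s : ℂ) ^ (b - 1) * ψ (t * s)) {t : ℝ} (ht : 0 < t)
    {m' : ℂ} (hm' : HasDerivAt m m' t) : t * m' + b * m t = ψ t := by
  have ht' : (t : ℂ) ≠ 0 := by exact_mod_cast ht.ne'
  have hb0 : b ≠ 0 := by rintro rfl; simp at hb
  have h1 : HasDerivAt (fun t : ℝ => (t : ℂ) ^ b * m t)
      (b * (t : ℂ) ^ (b - 1) * m t + (t : ℂ) ^ b * m') t := by
    exact (hasDerivAt_ofReal_cpow_const ht.ne' hb0).mul hm'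
  have h2 : HasDerivAt (fun t : ℝ => ∫ s in (0 : ℝ)..t, (s : ℂ) ^ (b - 1) * ψ s)
      ((t : ℂ) ^ (b - 1) * ψ t) t := by
    have hca : ∀ s : ℝ, 0 < s → ContinuousAt (fun s : ℝ => (s : ℂ) ^ (b - 1) * ψ s) s :=
      fun s hs => (Complex.continuousAt_ofReal_cpow_const s _ (Or.inr hs.ne')).mul hψ.continuousAt
    refine intervalIntegral.integral_hasDerivAt_right (intervalIntegrable_cpow_mul hb hψ _ _) ?_
      (hca t ht)
    exact ContinuousOn.stronglyMeasurableAtFilter isOpen_Ioi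
      (fun s hs => (hca s hs).continuousWithinAt) t ht
  have h3 := h1.unique (h2.congr_of_eventuallyEq (by
    filter_upwards [lt_mem_nhds ht] with s hs
    rw [hm, cpow_mul_scaleMean hs]))
  have h4 : (t : ℂ) ^ b = (t : ℂ) ^ (b - 1) * t := by
    nth_rewrite 1 [show b = b - 1 + 1 by ring]
    rw [Complex.cpow_add _ _ ht', Complex.cpow_one]
  have h5 : (t : ℂ) ^ (b - 1) ≠ 0 := by simp [Complex.cpow_eq_zero_iff, ht']
  rw [h4] at h3
  refine mul_left_cancel₀ h5 ?_
  linear_combination h3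

theorem euler_scaleMean {b : ℂ} (hb : 0 < b.re) {ψ m : ℝ → ℂ} (hψ : Continuous ψ)
    (hm : ∀ t, m t = ∫ s in (0 : ℝ)..1, (s : ℂ) ^ (b - 1) * ψ (t * s)) {t : ℝ}
    {m' : ℂ} (hm' : HasDerivAt m m' t) : t * m' + b * m t = ψ t := by
  have hb0 : b ≠ 0 := by rintro rfl; simp at hb
  rcases lt_trichotomy t 0 with ht | rfl | ht
  · have h1 : HasDerivAt (fun t => m (-t)) (-m') (-t) := by
      have h := HasDerivAt.scomp (-t) (h := fun t => -t) (g₁ := m) (by simpa using hm')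
        (hasDerivAt_neg (-t))
      simpa [Function.comp_def] using h
    have h2 := euler_scaleMean_of_pos hb (ψ := fun t => ψ (-t)) (m := fun t => m (-t))
      (hψ.comp continuous_neg) (fun t => by rw [hm]; simp) (neg_pos.2 ht) h1
    simpa using h2
  · have h1 : ∫ s in (0 : ℝ)..1, (s : ℂ) ^ (b - 1) = 1 / b := by
      rw [integral_cpow (Or.inl (by simpa using hb))]
      simp [hb0]
    rw [hm 0]
    simp only [zero_mul, Complex.ofReal_zero, zero_add]
    rw [intervalIntegral.integral_mul_const, h1]
    field_simp
  · exact euler_scaleMean_of_pos hb hψ hm ht hm'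

theorem scaleMean_eq_zero {b : ℂ} {ψ : ℝ → ℂ} {R : ℝ} (hR0 : 0 ≤ R) (hR : ∀ t, R < |t| → ψ t = 0)
    (h : ∫ s in Ioi (0 : ℝ), (s : ℂ) ^ (b - 1) * ψ s = 0) {t : ℝ} (ht : R < t) :
    ∫ s in (0 : ℝ)..1, (s : ℂ) ^ (b - 1) * ψ (t * s) = 0 := by
  have ht0 : 0 < t := hR0.trans_lt ht
  have h1 := cpow_mul_scaleMean (b := b) (ψ := ψ) ht0
  rw [intervalIntegral.integral_of_le ht0.le, ← setIntegral_eq_of_subset_of_forall_sdiff_eq_zero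
    measurableSet_Ioi Ioc_subset_Ioi_self (fun s hs => ?_), h, mul_eq_zero] at h1
  · have ht' : (t : ℂ) ≠ 0 := by exact_mod_cast ht0.ne'
    exact h1.resolve_left (by simp [Complex.cpow_eq_zero_iff, ht'])
  · have h2 : t < s := by
      by_contra hcon
      exact hs.2 ⟨hs.1, not_lt.1 hcon⟩
    rw [hR s ((ht.trans h2).trans_le (le_abs_self s)), mul_zero]

theorem integral_log_mul_euler {h : ℝ → ℂ} (hh : ContDiff ℝ ∞ h) {R : ℝ}
    (hR : ∀ t, R < |t| → h t = 0) :
    ∫ t in Ioi (0 : ℝ), ((Real.log t : ℝ) : ℂ) * (t * deriv h t + h t)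
      = -∫ t in Ioi (0 : ℝ), h t := by
  have hd : ContDiff ℝ ∞ (deriv h) := (contDiff_infty_iff_deriv.1 hh).2
  have hE : ContDiff ℝ ∞ fun t : ℝ => (t : ℂ) * deriv h t + h t :=
    (Complex.ofRealCLM.contDiff.mul hd).add hh
  have hdR : ∀ t, R < |t| → deriv h t = 0 := fun t ht => by
    rw [← iteratedDeriv_one]
    exact iteratedDeriv_eq_zero_of_support hR 1 t ht
  have i1 : IntegrableOn (fun t : ℝ => ((Real.log t : ℝ) : ℂ) * (t * deriv h t + h t)) (Ioi 0) := by
    simpa using integrableOn_weight_mul integrableOn_log 0 ⟨_, mem_testFunctions_real hE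
      (R := R) fun t ht => by simp [hR t ht, hdR t ht]⟩
  have i2 : IntegrableOn h (Ioi 0) :=
    (hh.continuous.integrable_of_hasCompactSupport (mem_testFunctions_real hh hR).2).integrableOn
  have key := integral_Ioi_of_hasDerivAt_of_tendsto (a := 0) (m := 0)
    (f := fun t : ℝ => ((t * Real.log t : ℝ) : ℂ) * h t)
    (f' := fun t : ℝ => ((Real.log t : ℝ) : ℂ) * (t * deriv h t + h t) + h t)
    (((Complex.continuous_ofReal.comp Real.continuous_mul_log).mul
      hh.continuous).continuousWithinAt) (fun t ht => ?_) (i1.add i2) ?_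
  · rw [integral_add i1 i2] at key
    simp only [zero_mul, Complex.ofReal_zero, sub_zero] at key
    exact eq_neg_of_add_eq_zero_left key
  · have h1 := (Real.hasDerivAt_mul_log (ne_of_gt ht)).ofReal_comp.mul
      (hh.differentiable (by simp) t).hasDerivAt
    refine h1.congr_deriv ?_
    push_cast
    ring
  · refine tendsto_const_nhds.congr' ?_
    filter_upwards [eventually_gt_atTop R] with t ht
    rw [hR t (ht.trans_le (le_abs_self t)), mul_zero]

theorem integral_Ioi_deriv {h : ℝ → ℂ} (hh : ContDiff ℝ ∞ h) {R : ℝ}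
    (hR : ∀ t, R < |t| → h t = 0) : ∫ t in Ioi (0 : ℝ), deriv h t = -h 0 := by
  have hd : Continuous (deriv h) := (contDiff_infty_iff_deriv.1 hh).2.continuous
  have hdR : ∀ t, R < |t| → deriv h t = 0 := fun t ht => by
    rw [← iteratedDeriv_one]
    exact iteratedDeriv_eq_zero_of_support hR 1 t ht
  have i2 : IntegrableOn (deriv h) (Ioi 0) :=
    (hd.integrable_of_hasCompactSupport
      (mem_testFunctions_real (contDiff_infty_iff_deriv.1 hh).2 hdR).2).integrableOn
  have key := integral_Ioi_of_hasDerivAt_of_tendsto' (a := 0) (m := 0) (f := h)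
    (fun t _ => (hh.differentiable (by simp) t).hasDerivAt) i2 (by
      refine tendsto_const_nhds.congr' ?_
      filter_upwards [eventually_gt_atTop R] with t ht
      rw [hR t (ht.trans_le (le_abs_self t))])
  rw [key, zero_sub]

end Line

section Manifold

variable {E : Type*} [NormedAddCommGroup E] [NormedSpace ℝ E]
  {H : Type*} [TopologicalSpace H] {I : ModelWithCorners ℝ E H}
  {M : Type*} [TopologicalSpace M] [ChartedSpace H M]
  [FiniteDimensional ℝ E] [I.Boundaryless] [IsManifold I ∞ M] [T2Space M]

theorem exists_eulerOp_of_re_pos {b : ℂ} (hb : 0 < b.re)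
    {g : testFunctions (I.prod 𝓘(ℝ, ℝ)) (M × ℝ)}
    (hpos : ∀ p, ∫ t in Ioi (0 : ℝ), (t : ℂ) ^ (b - 1) * (g : M × ℝ → ℂ) (p, t) = 0)
    (hneg : ∀ p, ∫ t in Ioi (0 : ℝ), (t : ℂ) ^ (b - 1) * (g : M × ℝ → ℂ) (p, -t) = 0) :
    ∃ Θ, eulerOp b Θ = g := by
  obtain ⟨R, hR⟩ := exists_bound_time g
  have hR' : ∀ p t, |R| < |t| → (g : M × ℝ → ℂ) (p, t) = 0 := fun p t ht =>
    hR p t ((le_abs_self R).trans_lt ht)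
  obtain ⟨κ, Θ, hκ, hΘ⟩ := exists_scaleMean hb |R| g
  have hΘ' : ∀ p t, (Θ : M × ℝ → ℂ) (p, t)
      = ∫ s in (0 : ℝ)..1, (s : ℂ) ^ (b - 1) * (g : M × ℝ → ℂ) (p, t * s) := by
    intro p t
    rw [hΘ]
    by_cases ht : |t| ≤ |R|
    · rw [hκ t ht, one_mul]
    · rw [not_le] at ht
      have h0 : ∫ s in (0 : ℝ)..1, (s : ℂ) ^ (b - 1) * (g : M × ℝ → ℂ) (p, t * s) = 0 := by
        rcases lt_abs.1 ht with h1 | h1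
        · exact scaleMean_eq_zero (abs_nonneg R) (hR' p) (hpos p) h1
        · simpa using scaleMean_eq_zero (ψ := fun t => (g : M × ℝ → ℂ) (p, -t)) (abs_nonneg R)
            (fun t ht => hR' p (-t) (by simpa using ht)) (hneg p) h1
      rw [h0, mul_zero]
  refine ⟨Θ, ?_⟩
  ext ⟨p, t⟩
  exact euler_scaleMean hb (ψ := fun t => (g : M × ℝ → ℂ) (p, t)) (contDiff_slice g p).continuous
    (hΘ' p) (hasDerivAt_timeDeriv Θ p t)

theorem exists_timeDeriv_eq {h : testFunctions (I.prod 𝓘(ℝ, ℝ)) (M × ℝ)}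
    (hh : ∀ p, ∫ t : ℝ, (h : M × ℝ → ℂ) (p, t) = 0) : ∃ Θ, timeDeriv Θ = h := by
  obtain ⟨R₀, hR₀⟩ := exists_bound_time h
  set R := |R₀|
  have hR : ∀ p t, R < |t| → (h : M × ℝ → ℂ) (p, t) = 0 := fun p t ht =>
    hR₀ p t ((le_abs_self R₀).trans_lt ht)
  have hR0 : 0 ≤ R := abs_nonneg R₀
  have hc : ∀ p, Continuous fun t => (h : M × ℝ → ℂ) (p, t) := fun p =>
    (contDiff_slice h p).continuous
  have hleft : ∀ p t, t ≤ -R → ∫ s in (-R)..t, (h : M × ℝ → ℂ) (p, s) = 0 := by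
    intro p t ht
    refine intervalIntegral.integral_zero_ae (Eventually.of_forall fun s hs => ?_)
    rw [uIoc_of_ge ht] at hs
    rcases hs.2.lt_or_eq with h1 | h1
    · exact hR p s (by rw [abs_of_neg (by linarith)]; linarith)
    · have hcl : (fun s => (h : M × ℝ → ℂ) (p, s)) s = 0 := by
        have hz : EqOn (fun s => (h : M × ℝ → ℂ) (p, s)) (fun _ => 0) (closure (Iio (-R))) :=
          EqOn.closure (fun x hx => hR p x (by
            rw [mem_Iio] at hx
            rw [abs_of_neg (by linarith)]
            linarith)) (hc p) continuous_const
        exact hz (by rw [closure_Iio]; exact h1.le)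
      exact hcl
  have hright : ∀ p t, R < t → ∫ s in (-R)..t, (h : M × ℝ → ℂ) (p, s) = 0 := by
    intro p t ht
    rw [← hh p, intervalIntegral.integral_eq_integral_of_support_subset]
    intro s hs
    have h1 : |s| ≤ R := not_lt.1 fun hcon => hs (hR p s hcon)
    have h2 := abs_le.1 h1
    refine ⟨lt_of_le_of_ne h2.1 fun h3 => hs ?_, h2.2.trans ht.le⟩
    have hz : EqOn (fun s => (h : M × ℝ → ℂ) (p, s)) (fun _ => 0) (closure (Iio (-R))) :=
      EqOn.closure (fun x hx => hR p x (by
        rw [mem_Iio] at hx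
        rw [abs_of_neg (by linarith)]
        linarith)) (hc p) continuous_const
    exact hz (by rw [closure_Iio]; exact h3.ge)
  obtain ⟨κ, hκ⟩ := exists_cutoff (max R 1)
  obtain ⟨R', hR'⟩ := exists_bound_support κ
  set S := |R'| + R + 1
  have hS : 0 < S := by positivity
  set Θ := (S : ℂ) • partialApply (unitMean (b := 1) (by simp))
    (reparam κ (g := fun x => x.1 - S * x.2) (by fun_prop) h) with hΘdef
  have hΘ : ∀ (p : M) (t : ℝ), (Θ : M × ℝ → ℂ) (p, t) = ∫ s in (-R)..t, (h : M × ℝ → ℂ) (p, s) := by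
    intro p t
    have h1 : (Θ : M × ℝ → ℂ) (p, t)
        = (κ : ℝ → ℂ) t * ((S : ℂ) * ∫ s in (0 : ℝ)..1, (h : M × ℝ → ℂ) (p, t - S * s)) := by
      change (S : ℂ) * (unitMean (b := 1) (by simp)).1 (slice _ (p, t)) = _
      rw [unitMean_apply, mul_left_comm ((κ : ℝ → ℂ) t),
        ← intervalIntegral.integral_const_mul ((κ : ℝ → ℂ) t)]
      refine congrArg ((S : ℂ) * ·) (intervalIntegral.integral_congr fun s hs => ?_)
      rw [uIcc_of_le zero_le_one] at hs
      change (s : ℂ) ^ ((1 : ℂ) - 1) *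
        ((κ : ℝ → ℂ) t * (κ : ℝ → ℂ) s * (h : M × ℝ → ℂ) (p, t - S * s)) = _
      rw [hκ s (by rw [abs_of_nonneg hs.1]; exact hs.2.trans (le_max_right _ _)), sub_self,
        Complex.cpow_zero]
      ring
    have h2 : (S : ℂ) * ∫ s in (0 : ℝ)..1, (h : M × ℝ → ℂ) (p, t - S * s)
        = ∫ s in (t - S)..t, (h : M × ℝ → ℂ) (p, s) := by
      have := intervalIntegral.smul_integral_comp_sub_mul (a := 0) (b := 1)
        (fun s => (h : M × ℝ → ℂ) (p, s)) S t
      rwa [mul_one, mul_zero, sub_zero, Complex.real_smul] at this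
    rw [h1, h2]
    by_cases ht' : R' < |t|
    · rw [hR' t ht', zero_mul]
      have h3 : R < |t| := by
        by_contra hcon
        have := hκ t ((not_lt.1 hcon).trans (le_max_left _ _))
        rw [hR' t ht'] at this
        exact zero_ne_one this
      rcases lt_abs.1 h3 with h4 | h4
      · exact (hright p t h4).symm
      · exact (hleft p t (by linarith)).symm
    · have h3 : t - S ≤ -R := by
        have h4 := (abs_le.1 (not_lt.1 ht')).2
        have h5 := le_abs_self R'
        simp only [S]
        linarith
      have h4 := intervalIntegral.integral_add_adjacent_intervals
        ((hc p).intervalIntegrable (-R) (t - S)) ((hc p).intervalIntegrable (μ := volume) (t - S) t)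
      rw [hleft p _ h3, zero_add] at h4
      rw [h4]
      by_cases h5 : |t| ≤ R
      · rw [hκ t (h5.trans (le_max_left _ _)), one_mul]
      · have h6 : ∫ s in (-R)..t, (h : M × ℝ → ℂ) (p, s) = 0 := by
          rcases lt_abs.1 (not_le.1 h5) with h7 | h7
          · exact hright p t h7
          · exact hleft p t (by linarith)
        rw [h6, mul_zero]
  refine ⟨Θ, ?_⟩
  ext ⟨p, t⟩
  have h1 : (fun t => (Θ : M × ℝ → ℂ) (p, t)) = fun t => ∫ s in (-R)..t, (h : M × ℝ → ℂ) (p, s) :=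
    funext (hΘ p)
  change deriv (fun t => (Θ : M × ℝ → ℂ) (p, t)) t = _
  rw [h1]
  exact (hc p).deriv_integral _ _ _

theorem mulTime_eq_of_eulerOp_one {g h : testFunctions (I.prod 𝓘(ℝ, ℝ)) (M × ℝ)}
    (hg : ∀ p, (g : M × ℝ → ℂ) (p, 0) = 0) (hh : eulerOp 1 h = timeDeriv g) : mulTime h = g := by
  have hh' : ∀ (p : M) (t : ℝ),
      (t : ℂ) * (timeDeriv h : M × ℝ → ℂ) (p, t) + 1 * (h : M × ℝ → ℂ) (p, t)
      = (timeDeriv g : M × ℝ → ℂ) (p, t) := fun p t =>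
    congrFun (congrArg (fun f : testFunctions (I.prod 𝓘(ℝ, ℝ)) (M × ℝ) => (f : M × ℝ → ℂ)) hh)
      (p, t)
  ext ⟨p, t⟩
  have h1 : ∀ t : ℝ, HasDerivAt (fun t : ℝ => (t : ℂ) * (h : M × ℝ → ℂ) (p, t)
      - (g : M × ℝ → ℂ) (p, t)) 0 t := fun t => by
    have h2 := ((hasDerivAt_id t).ofReal_comp.mul (hasDerivAt_timeDeriv h p t)).sub
      (hasDerivAt_timeDeriv g p t)
    refine h2.congr_deriv ?_
    rw [← hh' p t]
    simp
    ring
  have h2 := is_const_of_deriv_eq_zero (fun t => (h1 t).differentiableAt)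
    (fun t => (h1 t).deriv) t 0
  simp only [Complex.ofReal_zero, zero_mul, hg, sub_zero] at h2
  exact sub_eq_zero.1 h2

theorem exists_eulerOp_zero {g : testFunctions (I.prod 𝓘(ℝ, ℝ)) (M × ℝ)}
    (hg : ∀ p, (g : M × ℝ → ℂ) (p, 0) = 0)
    (hlog : ∀ p, (∫ t in Ioi (0 : ℝ), ((Real.log t : ℝ) : ℂ) * (timeDeriv g : M × ℝ → ℂ) (p, t))
      + ∫ t in Ioi (0 : ℝ), ((Real.log t : ℝ) : ℂ) * (timeDeriv g : M × ℝ → ℂ) (p, -t) = 0) :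
    ∃ Θ, eulerOp 0 Θ = g := by
  obtain ⟨R, hR⟩ := exists_bound_time g
  have hneg : ∀ (f : ℝ → ℂ) (t : ℝ), deriv (fun t => f (-t)) t = -deriv f (-t) := fun f t =>
    deriv_comp_neg f t
  obtain ⟨h, hh⟩ := exists_eulerOp_of_re_pos (b := 1) (g := timeDeriv g) (by simp)
    (fun p => by
      have := integral_Ioi_deriv (contDiff_slice g p) (hR p)
      rw [hg, neg_zero] at this
      simp only [sub_self, Complex.cpow_zero, one_mul]
      exact this)
    (fun p => by
      have := integral_Ioi_deriv (h := fun t => (g : M × ℝ → ℂ) (p, -t))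
        ((contDiff_slice g p).comp contDiff_neg) (R := R) (fun t ht => hR p _ (by simpa using ht))
      simp only [neg_zero, hg] at this
      simp only [hneg (fun t => (g : M × ℝ → ℂ) (p, t)), integral_neg, neg_eq_zero] at this
      simp only [sub_self, Complex.cpow_zero, one_mul]
      exact this)
  have hth := mulTime_eq_of_eulerOp_one hg hh
  have hh' : ∀ (p : M) (t : ℝ),
      (t : ℂ) * deriv (fun t => (h : M × ℝ → ℂ) (p, t)) t + (h : M × ℝ → ℂ) (p, t)
      = (timeDeriv g : M × ℝ → ℂ) (p, t) := fun p t => by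
    have := congrFun (congrArg (fun f : testFunctions (I.prod 𝓘(ℝ, ℝ)) (M × ℝ) =>
      (f : M × ℝ → ℂ)) hh) (p, t)
    rw [← this, ← one_mul ((h : M × ℝ → ℂ) (p, t))]
    rfl
  obtain ⟨R', hR'⟩ := exists_bound_time h
  have hint : ∀ p, ∫ t : ℝ, (h : M × ℝ → ℂ) (p, t) = 0 := by
    intro p
    have hi : Integrable fun t => (h : M × ℝ → ℂ) (p, t) :=
      (contDiff_slice h p).continuous.integrable_of_hasCompactSupport (slice h p).2.2
    have h1 := integral_log_mul_euler (contDiff_slice h p) (hR' p)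
    have h2 := integral_log_mul_euler (h := fun t => (h : M × ℝ → ℂ) (p, -t))
      ((contDiff_slice h p).comp contDiff_neg) (R := R') (fun t ht => hR' p _ (by simpa using ht))
    have h3 := hlog p
    have h4 : ∀ t : ℝ, (t : ℂ) * deriv (fun t => (h : M × ℝ → ℂ) (p, -t)) t
        + (h : M × ℝ → ℂ) (p, -t) = (timeDeriv g : M × ℝ → ℂ) (p, -t) := fun t => by
      rw [← hh' p (-t), hneg (fun t => (h : M × ℝ → ℂ) (p, t))]
      push_cast
      ring
    simp only [hh'] at h1
    simp only [h4] at h2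
    rw [h1, h2, integral_comp_neg_Ioi (f := fun t => (h : M × ℝ → ℂ) (p, t)), neg_zero] at h3
    rw [← intervalIntegral.integral_Iic_add_Ioi hi.integrableOn hi.integrableOn (b := 0)]
    linear_combination -h3
  obtain ⟨Θ, hΘ⟩ := exists_timeDeriv_eq hint
  exact ⟨Θ, by rw [eulerOp, hΘ, hth, zero_smul, add_zero]⟩

end Manifold

/-! ### Homogeneous distributions on the line and on `M × ℝ` -/

/-- `T` is homogeneous of degree `a` for the dilations of the line. -/
def LineHomogeneous (a : ℂ) (T : distributions 𝓘(ℝ, ℝ) ℝ) : Prop :=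
  ∀ (s : ℝ), 0 < s → ∀ ψ ψ' : testFunctions 𝓘(ℝ, ℝ) ℝ,
    (∀ t, (ψ' : ℝ → ℂ) t = (ψ : ℝ → ℂ) (s⁻¹ * t)) → T.1 ψ' = (s : ℂ) ^ a * T.1 ψ

section Manifold

variable {E : Type*} [NormedAddCommGroup E] [NormedSpace ℝ E]
  {H : Type*} [TopologicalSpace H] {I : ModelWithCorners ℝ E H}
  {M : Type*} [TopologicalSpace M] [ChartedSpace H M]
  [FiniteDimensional ℝ E] [I.Boundaryless] [IsManifold I ∞ M] [T2Space M]

theorem tensorSpace_le_homogeneous {a : ℂ} {T : distributions 𝓘(ℝ, ℝ) ℝ}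
    (hT : LineHomogeneous a T) : tensorSpace I M T ≤ homogeneous (dilation I M) a := by
  rintro _ ⟨v, rfl⟩ s Φ
  have h : partialApply T (pullback (dilation I M s⁻¹) Φ)
      = ((s : ℝ) : ℂ) ^ a • partialApply T Φ := by
    ext p
    exact hT s s.2 (slice Φ p) _ fun t => rfl
  change v.1 (partialApply T (pullback (dilation I M s⁻¹) Φ)) = _ * v.1 (partialApply T Φ)
  rw [h, map_smul, smul_eq_mul]

theorem tensor_outer (v : distributions I M) (T : distributions 𝓘(ℝ, ℝ) ℝ)
    (φ : testFunctions I M) (χ : testFunctions 𝓘(ℝ, ℝ) ℝ) :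
    (tensor v T).1 (outer φ χ) = T.1 χ * v.1 φ := by
  have h : partialApply T (outer φ χ) = T.1 χ • φ := by
    ext p
    change T.1 (slice (outer φ χ) p) = T.1 χ * (φ : M → ℂ) p
    rw [slice_outer, map_smul, smul_eq_mul, mul_comm]
  change v.1 (partialApply T (outer φ χ)) = _
  rw [h, map_smul, smul_eq_mul]

/-- The distribution `φ ↦ ⟨u, φ ⊗ χ⟩` on `M`. -/
noncomputable def contract (u : distributions (I.prod 𝓘(ℝ, ℝ)) (M × ℝ))
    (χ : testFunctions 𝓘(ℝ, ℝ) ℝ) : distributions I M :=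
  ⟨{ toFun := fun φ => u.1 (outer φ χ)
     map_add' := fun φ ψ => by
      rw [← map_add]
      congr 1
      ext x
      exact add_mul _ _ _
     map_smul' := fun c φ => by
      rw [RingHom.id_apply, ← map_smul]
      congr 1
      ext x
      exact mul_assoc _ _ _ },
   fun _ hφ => u.2 _ (tendstoZero_outer hφ χ)⟩

theorem disjoint_tensorSpace {T₁ T₂ : distributions 𝓘(ℝ, ℝ) ℝ} {χ : testFunctions 𝓘(ℝ, ℝ) ℝ}
    (h₁ : T₁.1 χ ≠ 0) (h₂ : T₂.1 χ = 0) :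
    Disjoint (tensorSpace I M T₁) (tensorSpace I M T₂) := by
  rw [Submodule.disjoint_def]
  rintro _ ⟨v, rfl⟩ ⟨v', hv'⟩
  have hv : v = 0 := by
    apply Subtype.ext
    ext φ
    have h := tensor_outer v T₁ φ χ
    rw [hv', tensor_outer, h₂, zero_mul] at h
    exact (mul_eq_zero.1 h.symm).resolve_left h₁
  rw [hv]
  rfl

/-- If the common kernel of `T₁` and `T₂` consists of the fibrewise images of the Euler operator,
the homogeneous distributions are the sums of the `v₁ ⊗ T₁` and the `v₂ ⊗ T₂`. -/
theorem homogeneous_eq_sup {a : ℂ} {T₁ T₂ : distributions 𝓘(ℝ, ℝ) ℝ}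
    (hT₁ : LineHomogeneous a T₁) (hT₂ : LineHomogeneous a T₂)
    {χ₁ χ₂ : testFunctions 𝓘(ℝ, ℝ) ℝ} (h₁₁ : T₁.1 χ₁ ≠ 0) (h₂₁ : T₂.1 χ₁ = 0) (h₂₂ : T₂.1 χ₂ ≠ 0)
    (hsolve : ∀ Ψ : testFunctions (I.prod 𝓘(ℝ, ℝ)) (M × ℝ), (∀ p, T₁.1 (slice Ψ p) = 0) →
      (∀ p, T₂.1 (slice Ψ p) = 0) → ∃ Θ, eulerOp a Θ = Ψ) :
    homogeneous (dilation I M) a = tensorSpace I M T₁ ⊔ tensorSpace I M T₂ ∧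
      Disjoint (tensorSpace I M T₁) (tensorSpace I M T₂) := by
  refine ⟨le_antisymm (fun u hu => ?_) (sup_le (tensorSpace_le_homogeneous hT₁)
    (tensorSpace_le_homogeneous hT₂)), disjoint_tensorSpace h₁₁ h₂₁⟩
  set η₁ := (T₁.1 χ₁)⁻¹ • χ₁
  set η₂ := (T₂.1 χ₂)⁻¹ • (χ₂ - T₁.1 χ₂ • η₁)
  have e₁₁ : T₁.1 η₁ = 1 := by
    rw [map_smul, smul_eq_mul, inv_mul_cancel₀ h₁₁]
  have e₂₁ : T₂.1 η₁ = 0 := by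
    rw [map_smul, h₂₁, smul_zero]
  have e₁₂ : T₁.1 η₂ = 0 := by
    rw [map_smul, map_sub, map_smul, e₁₁, smul_eq_mul, smul_eq_mul, mul_one, sub_self, mul_zero]
  have e₂₂ : T₂.1 η₂ = 1 := by
    rw [map_smul, map_sub, map_smul, e₂₁, smul_zero, sub_zero, smul_eq_mul, inv_mul_cancel₀ h₂₂]
  refine Submodule.mem_sup.2 ⟨tensor (contract u η₁) T₁, ⟨_, rfl⟩, tensor (contract u η₂) T₂,
    ⟨_, rfl⟩, ?_⟩
  apply Subtype.ext
  refine LinearMap.ext fun Φ => ?_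
  change u.1 (outer (partialApply T₁ Φ) η₁) + u.1 (outer (partialApply T₂ Φ) η₂) = u.1 Φ
  have hslice : ∀ p, slice (Φ - (outer (partialApply T₁ Φ) η₁ + outer (partialApply T₂ Φ) η₂)) p
      = slice Φ p - (T₁.1 (slice Φ p) • η₁ + T₂.1 (slice Φ p) • η₂) := fun p => rfl
  obtain ⟨Θ, hΘ⟩ := hsolve (Φ - (outer (partialApply T₁ Φ) η₁ + outer (partialApply T₂ Φ) η₂))
    (fun p => by rw [hslice]; simp [e₁₁, e₁₂]) (fun p => by rw [hslice]; simp [e₂₁, e₂₂])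
  have h := apply_eulerOp_of_mem_homogeneous hu Θ
  rw [hΘ, map_sub, map_add, sub_eq_zero] at h
  exact h.symm

end Manifold

section Line

theorem integralDeriv_apply (w : ℝ → ℂ) (hw : ∀ R : ℝ, IntegrableOn w (Ioc 0 R)) (k : ℕ)
    (ψ : testFunctions 𝓘(ℝ, ℝ) ℝ) : (integralDeriv w hw k).1 ψ
      = ∫ t in Ioi (0 : ℝ), w t * iteratedDeriv k (ψ : ℝ → ℂ) t := rfl

theorem iteratedDeriv_dilate (k : ℕ) {s : ℝ} {ψ ψ' : testFunctions 𝓘(ℝ, ℝ) ℝ}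
    (h : ∀ t, (ψ' : ℝ → ℂ) t = (ψ : ℝ → ℂ) (s⁻¹ * t)) (t : ℝ) :
    iteratedDeriv k (ψ' : ℝ → ℂ) t
      = ((s : ℂ)⁻¹) ^ k * iteratedDeriv k (ψ : ℝ → ℂ) (s⁻¹ * t) := by
  have h1 : (ψ' : ℝ → ℂ) = fun t => (ψ : ℝ → ℂ) (s⁻¹ * t) := funext h
  have h2 := congrFun (iteratedDeriv_comp_const_smul (n := k)
    ((testFunctions_real_contDiff ψ).of_le (by exact_mod_cast le_top)) s⁻¹) t
  rw [h1]
  simpa using h2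

theorem integralDeriv_dilate (w : ℝ → ℂ) (hw : ∀ R : ℝ, IntegrableOn w (Ioc 0 R)) (k : ℕ) {s : ℝ}
    (hs : 0 < s) {ψ ψ' : testFunctions 𝓘(ℝ, ℝ) ℝ}
    (h : ∀ t, (ψ' : ℝ → ℂ) t = (ψ : ℝ → ℂ) (s⁻¹ * t)) :
    (integralDeriv w hw k).1 ψ' = (s : ℂ) * ((s : ℂ)⁻¹) ^ k *
      ∫ t in Ioi (0 : ℝ), w (s * t) * iteratedDeriv k (ψ : ℝ → ℂ) t := by
  have h1 := integral_comp_mul_left_Ioi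
    (fun t => w (s * t) * iteratedDeriv k (ψ : ℝ → ℂ) t) 0 (inv_pos.2 hs)
  rw [mul_zero, inv_inv, Complex.real_smul] at h1
  rw [integralDeriv_apply, mul_right_comm, ← h1, mul_comm, ← integral_const_mul]
  congr 1
  ext t
  rw [iteratedDeriv_dilate k h, mul_inv_cancel_left₀ hs.ne']
  ring

theorem tPlus_apply_of_ne {a : ℂ} (ha : ∀ n : ℕ, a ≠ -(n : ℂ)) (ψ : testFunctions 𝓘(ℝ, ℝ) ℝ) :
    (tPlus a).1 ψ = ((-1) ^ order a / ∏ j ∈ Finset.range (order a), (a + j)) *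
      ∫ t in Ioi (0 : ℝ), (t : ℂ) ^ (a - 1 + (order a : ℂ)) *
        iteratedDeriv (order a) (ψ : ℝ → ℂ) t := by
  rw [tPlus, if_neg (by push Not; exact ha)]
  rfl

theorem tPlus_coeff_ne_zero {a : ℂ} (ha : ∀ n : ℕ, a ≠ -(n : ℂ)) :
    (-1) ^ order a / ∏ j ∈ Finset.range (order a), (a + j) ≠ 0 :=
  div_ne_zero (pow_ne_zero _ (by norm_num)) (Finset.prod_ne_zero_iff.2 fun j _ h =>
    ha j (eq_neg_of_add_eq_zero_left h))

theorem order_neg (n : ℕ) : order (-(n : ℂ)) = n + 1 := by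
  simp only [order, Complex.neg_re, Complex.natCast_re, neg_neg, Int.floor_natCast]
  omega

/-- The factor in front of the integral defining `t_+^{-n-1}`. -/
noncomputable def logCoeff (n : ℕ) : ℂ := (-1) ^ (n + 1) / ∏ j ∈ Finset.range n, (-(n : ℂ) + j)

theorem logCoeff_ne_zero (n : ℕ) : logCoeff n ≠ 0 := by
  refine div_ne_zero (pow_ne_zero _ (by norm_num)) (Finset.prod_ne_zero_iff.2 fun j hj h => ?_)
  rw [neg_add_eq_zero, Nat.cast_inj] at h
  exact (Finset.mem_range.1 hj).ne' h

theorem tPlus_neg_apply (n : ℕ) (ψ : testFunctions 𝓘(ℝ, ℝ) ℝ) :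
    (tPlus (-(n : ℂ))).1 ψ = logCoeff n *
      ∫ t in Ioi (0 : ℝ), ((Real.log t : ℝ) : ℂ) * iteratedDeriv (n + 1) (ψ : ℝ → ℂ) t := by
  rw [tPlus, if_pos ⟨n, rfl⟩]
  simp only [order_neg]
  rfl

theorem iteratedDeriv_reflection (k : ℕ) (ψ : testFunctions 𝓘(ℝ, ℝ) ℝ) (t : ℝ) :
    iteratedDeriv k (pullback reflection ψ : ℝ → ℂ) t
      = (-1) ^ k * iteratedDeriv k (ψ : ℝ → ℂ) (-t) := by
  have h := iteratedDeriv_comp_neg k (ψ : ℝ → ℂ) t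
  rw [Complex.real_smul] at h
  push_cast at h
  exact h

theorem lineHomogeneous_tMinus {a : ℂ} (h : LineHomogeneous a (tPlus a)) :
    LineHomogeneous a (tMinus a) := fun s hs ψ ψ' hψ =>
  h s hs (pullback reflection ψ) (pullback reflection ψ') fun t => by
    change (ψ' : ℝ → ℂ) (-t) = (ψ : ℝ → ℂ) (-(s⁻¹ * t))
    rw [hψ, mul_neg]

theorem lineHomogeneous_tPlus {a : ℂ} (ha : ∀ n : ℕ, a ≠ -(n : ℂ)) :
    LineHomogeneous a (tPlus a) := by
  intro s hs ψ ψ' hψ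
  have hs' : (s : ℂ) ≠ 0 := by exact_mod_cast hs.ne'
  have h1 := integralDeriv_dilate (fun t => (t : ℂ) ^ (a - 1 + (order a : ℂ)))
    (integrableOn_cpow (neg_one_lt_re a)) (order a) hs hψ
  rw [integralDeriv_apply] at h1
  have h2 : ∫ t in Ioi (0 : ℝ), ((s * t : ℝ) : ℂ) ^ (a - 1 + (order a : ℂ)) *
        iteratedDeriv (order a) (ψ : ℝ → ℂ) t
      = (s : ℂ) ^ (a - 1 + (order a : ℂ)) * ∫ t in Ioi (0 : ℝ),
        (t : ℂ) ^ (a - 1 + (order a : ℂ)) * iteratedDeriv (order a) (ψ : ℝ → ℂ) t := by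
    rw [← integral_const_mul]
    refine setIntegral_congr_fun measurableSet_Ioi fun t ht => ?_
    rw [Complex.ofReal_mul, Complex.mul_cpow_ofReal_nonneg hs.le (le_of_lt ht), mul_assoc]
  rw [tPlus_apply_of_ne ha, tPlus_apply_of_ne ha, h1, h2, Complex.cpow_add _ _ hs',
    Complex.cpow_sub _ _ hs', Complex.cpow_one, Complex.cpow_natCast,
    inv_pow]
  field_simp

theorem integral_iteratedDeriv_succ (n : ℕ) (ψ : testFunctions 𝓘(ℝ, ℝ) ℝ) :
    ∫ t in Ioi (0 : ℝ), iteratedDeriv (n + 1) (ψ : ℝ → ℂ) t = -iteratedDeriv n (ψ : ℝ → ℂ) 0 := by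
  obtain ⟨R, hR⟩ := exists_bound_support ψ
  rw [iteratedDeriv_succ]
  exact integral_Ioi_deriv
    (by rw [iteratedDeriv_eq_iterate]; exact (testFunctions_real_contDiff ψ).iterate_deriv n)
    (iteratedDeriv_eq_zero_of_support hR n)

theorem tPlus_neg_dilate (n : ℕ) {s : ℝ} (hs : 0 < s) {ψ ψ' : testFunctions 𝓘(ℝ, ℝ) ℝ}
    (h : ∀ t, (ψ' : ℝ → ℂ) t = (ψ : ℝ → ℂ) (s⁻¹ * t)) :
    (tPlus (-(n : ℂ))).1 ψ' = (s : ℂ) ^ (-(n : ℂ)) * ((tPlus (-(n : ℂ))).1 ψ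
      - logCoeff n * Real.log s * iteratedDeriv n (ψ : ℝ → ℂ) 0) := by
  have hs' : (s : ℂ) ≠ 0 := by exact_mod_cast hs.ne'
  have h1 := integralDeriv_dilate _ integrableOn_log (n + 1) hs h
  rw [integralDeriv_apply] at h1
  have i1 := integrableOn_weight_mul integrableOn_log (n + 1) ψ
  have i2 : IntegrableOn (fun t => (Real.log s : ℂ) * iteratedDeriv (n + 1) (ψ : ℝ → ℂ) t)
      (Ioi 0) := integrableOn_weight_mul (w := fun _ => (Real.log s : ℂ))
        (fun R => integrableOn_const (by simp)) (n + 1) ψ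
  have h2 : ∫ t in Ioi (0 : ℝ), ((Real.log (s * t) : ℝ) : ℂ) *
        iteratedDeriv (n + 1) (ψ : ℝ → ℂ) t
      = (∫ t in Ioi (0 : ℝ), ((Real.log t : ℝ) : ℂ) * iteratedDeriv (n + 1) (ψ : ℝ → ℂ) t)
        - Real.log s * iteratedDeriv n (ψ : ℝ → ℂ) 0 := by
    rw [sub_eq_add_neg, ← mul_neg, ← integral_iteratedDeriv_succ, ← integral_const_mul,
      ← integral_add i1 i2]
    refine setIntegral_congr_fun measurableSet_Ioi fun t ht => ?_
    rw [Real.log_mul hs.ne' (ne_of_gt ht)]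
    push_cast
    ring
  rw [tPlus_neg_apply, tPlus_neg_apply, h1, h2, Complex.cpow_neg, Complex.cpow_natCast, inv_pow,
    pow_succ]
  field_simp

theorem sign_mul_sign (n : ℕ) : (-1 : ℂ) ^ (-(n : ℤ) - 1) * (-1) ^ (n + 1) = 1 := by
  rw [← zpow_natCast, ← zpow_add₀ (by norm_num)]
  push_cast
  rw [show -(n : ℤ) - 1 + (n + 1) = 0 by ring, zpow_zero]

theorem lineHomogeneous_odd (n : ℕ) : LineHomogeneous (-(n : ℂ))
    (tPlus (-(n : ℂ)) + (-1 : ℂ) ^ (-(n : ℤ) - 1) • tMinus (-(n : ℂ))) := by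
  intro s hs ψ ψ' hψ
  have h1 := tPlus_neg_dilate n hs hψ
  have h2 := tPlus_neg_dilate n hs (ψ := pullback reflection ψ) (ψ' := pullback reflection ψ')
    fun t => by
      change (ψ' : ℝ → ℂ) (-t) = (ψ : ℝ → ℂ) (-(s⁻¹ * t))
      rw [hψ, mul_neg]
  rw [iteratedDeriv_reflection, neg_zero] at h2
  change (tPlus (-(n : ℂ))).1 ψ' + (-1 : ℂ) ^ (-(n : ℤ) - 1) *
      (tPlus (-(n : ℂ))).1 (pullback reflection ψ') = _ * ((tPlus (-(n : ℂ))).1 ψ +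
      (-1 : ℂ) ^ (-(n : ℤ) - 1) * (tPlus (-(n : ℂ))).1 (pullback reflection ψ))
  have h3 := sign_mul_sign n
  rw [pow_succ] at h3
  rw [h1, h2]
  linear_combination ((s : ℂ) ^ (-(n : ℂ)) * logCoeff n * Real.log s *
    iteratedDeriv n (ψ : ℝ → ℂ) 0) * h3

theorem lineHomogeneous_diracDeriv (n : ℕ) : LineHomogeneous (-(n : ℂ)) (diracDeriv n) := by
  intro s hs ψ ψ' hψ
  change (-1) ^ n * iteratedDeriv n (ψ' : ℝ → ℂ) 0
    = _ * ((-1) ^ n * iteratedDeriv n (ψ : ℝ → ℂ) 0)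
  rw [iteratedDeriv_dilate n hψ, mul_zero, Complex.cpow_neg, Complex.cpow_natCast, inv_pow]
  ring

theorem odd_apply (n : ℕ) (ψ : testFunctions 𝓘(ℝ, ℝ) ℝ) :
    (tPlus (-(n : ℂ)) + (-1 : ℂ) ^ (-(n : ℤ) - 1) • tMinus (-(n : ℂ))).1 ψ = logCoeff n *
      ((∫ t in Ioi (0 : ℝ), ((Real.log t : ℝ) : ℂ) * iteratedDeriv (n + 1) (ψ : ℝ → ℂ) t) +
      ∫ t in Ioi (0 : ℝ), ((Real.log t : ℝ) : ℂ) * iteratedDeriv (n + 1) (ψ : ℝ → ℂ) (-t)) := by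
  change (tPlus (-(n : ℂ))).1 ψ + (-1 : ℂ) ^ (-(n : ℤ) - 1) *
    (tPlus (-(n : ℂ))).1 (pullback reflection ψ) = _
  simp only [tPlus_neg_apply, iteratedDeriv_reflection, mul_left_comm _ ((-1 : ℂ) ^ (n + 1)),
    integral_const_mul]
  linear_combination (logCoeff n * ∫ t in Ioi (0 : ℝ), ((Real.log t : ℝ) : ℂ) *
    iteratedDeriv (n + 1) (ψ : ℝ → ℂ) (-t)) * sign_mul_sign n

end Line

/-! ### Nonvanishing on test functions supported in the open half line -/

section HalfLine

theorem integrable_mul_of_support {f χ : ℝ → ℂ} {ε R : ℝ} (hf : ContinuousOn f (Ioi 0))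
    (hχ : Continuous χ) (hε : 0 < ε) (h0 : ∀ t < ε, χ t = 0) (hR : ∀ t, R < |t| → χ t = 0) :
    Integrable fun t => f t * χ t := by
  refine Continuous.integrable_of_hasCompactSupport (continuous_iff_continuousAt.2 fun t => ?_)
    (HasCompactSupport.intro (isCompact_closedBall (0 : ℝ) R) fun t ht => ?_)
  · rcases le_or_gt t 0 with ht | ht
    · refine (continuousAt_const (y := (0 : ℂ))).congr ?_
      filter_upwards [gt_mem_nhds (ht.trans_lt hε)] with s hs
      rw [h0 s hs, mul_zero]
    · exact (hf.continuousAt (Ioi_mem_nhds ht)).mul hχ.continuousAt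
  · rw [hR t (by simpa using ht), mul_zero]

theorem integral_mul_deriv_of_support {f f' χ : ℝ → ℂ} {ε R : ℝ}
    (hf : ∀ t, 0 < t → HasDerivAt f (f' t) t) (hf' : ContinuousOn f' (Ioi 0))
    (hχ : ContDiff ℝ ∞ χ) (hε : 0 < ε) (h0 : ∀ t < ε, χ t = 0) (hR : ∀ t, R < |t| → χ t = 0) :
    ∫ t in Ioi (0 : ℝ), f t * deriv χ t = -∫ t in Ioi (0 : ℝ), f' t * χ t := by
  have hdR : ∀ t, R < |t| → deriv χ t = 0 := fun t ht => by
    rw [← iteratedDeriv_one]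
    exact iteratedDeriv_eq_zero_of_support hR 1 t ht
  have hd0 : ∀ t < ε, deriv χ t = 0 := fun t ht => by
    have : χ =ᶠ[𝓝 t] fun _ => 0 := by
      filter_upwards [gt_mem_nhds ht] with s hs
      exact h0 s hs
    rw [this.deriv_eq, deriv_const]
  have hfc : ContinuousOn f (Ioi 0) := fun t ht => (hf t ht).continuousAt.continuousWithinAt
  have i1 := integrable_mul_of_support hf' hχ.continuous hε h0 hR
  have i2 := integrable_mul_of_support hfc (contDiff_infty_iff_deriv.1 hχ).2.continuous hε hd0 hdR
  have key := integral_Ioi_of_hasDerivAt_of_tendsto (a := 0) (m := 0) (f := fun t => f t * χ t)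
    (f' := fun t => f' t * χ t + f t * deriv χ t) (ContinuousAt.continuousWithinAt ?_)
    (fun t ht => (hf t ht).mul (hχ.differentiable (by simp) t).hasDerivAt)
    (i1.integrableOn.add i2.integrableOn) ?_
  · rw [integral_add i1.integrableOn i2.integrableOn, h0 0 hε, mul_zero, sub_zero] at key
    exact eq_neg_of_add_eq_zero_right key
  · refine (continuousAt_const (y := (0 : ℂ))).congr ?_
    filter_upwards [gt_mem_nhds hε] with s hs
    rw [h0 s hs, mul_zero]
  · refine tendsto_const_nhds.congr' ?_
    filter_upwards [eventually_gt_atTop R] with t ht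
    rw [hR t (ht.trans_le (le_abs_self t)), mul_zero]

theorem integral_cpow_mul_iteratedDeriv {ε R : ℝ} (hε : 0 < ε) (k : ℕ) :
    ∀ {β : ℂ}, (∀ j < k, β - j ≠ 0) → ∃ c : ℂ, c ≠ 0 ∧ ∀ χ : ℝ → ℂ, ContDiff ℝ ∞ χ →
      (∀ t < ε, χ t = 0) → (∀ t, R < |t| → χ t = 0) →
      ∫ t in Ioi (0 : ℝ), (t : ℂ) ^ β * iteratedDeriv k χ t
        = c * ∫ t in Ioi (0 : ℝ), (t : ℂ) ^ (β - k) * χ t := by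
  induction k with
  | zero => exact fun _ => ⟨1, one_ne_zero, fun χ _ _ _ => by simp⟩
  | succ k ih =>
    intro β hβ
    obtain ⟨c, hc, h⟩ := ih (β := β) fun j hj => hβ j (by omega)
    refine ⟨-(c * (β - k)), neg_ne_zero.2 (mul_ne_zero hc (hβ k (Nat.lt_succ_self k))),
      fun χ hχ h0 hR => ?_⟩
    have hdR : ∀ t, R < |t| → deriv χ t = 0 := fun t ht => by
      rw [← iteratedDeriv_one]
      exact iteratedDeriv_eq_zero_of_support hR 1 t ht
    have hd0 : ∀ t < ε, deriv χ t = 0 := fun t ht => by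
      have : χ =ᶠ[𝓝 t] fun _ => 0 := by
        filter_upwards [gt_mem_nhds ht] with s hs
        exact h0 s hs
      rw [this.deriv_eq, deriv_const]
    rw [iteratedDeriv_succ', h _ (contDiff_infty_iff_deriv.1 hχ).2 hd0 hdR,
      integral_mul_deriv_of_support (f := fun t : ℝ => (t : ℂ) ^ (β - k))
        (f' := fun t : ℝ => (β - k) * (t : ℂ) ^ (β - k - 1))
        (fun t ht => hasDerivAt_ofReal_cpow_const ht.ne' (hβ k (Nat.lt_succ_self k)))
        (fun t ht => (continuousAt_const.mul (Complex.continuousAt_ofReal_cpow_const t _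
          (Or.inr (ne_of_gt ht)))).continuousWithinAt) hχ hε h0 hR]
    simp only [mul_assoc, integral_const_mul]
    push_cast
    rw [sub_sub]
    ring

theorem exists_integral_cpow_ne_zero (γ : ℂ) :
    ∃ χ : testFunctions 𝓘(ℝ, ℝ) ℝ, (∀ t < 1 / 2, (χ : ℝ → ℂ) t = 0) ∧
      (∀ t, 2 < |t| → (χ : ℝ → ℂ) t = 0) ∧
      ∫ t in Ioi (0 : ℝ), (t : ℂ) ^ γ * (χ : ℝ → ℂ) t ≠ 0 := by
  let b : ContDiffBump (1 : ℝ) := ⟨1 / 4, 1 / 2, by norm_num, by norm_num⟩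
  have hb : ∀ t < 1 / 2, b t = 0 := fun t ht => b.zero_of_le_dist (by
    rw [Real.dist_eq, abs_sub_comm]
    exact le_trans (show (1 / 2 : ℝ) ≤ 1 - t by linarith) (le_abs_self _))
  have hb2 : ∀ t, 2 < |t| → b t = 0 := fun t ht => by
    rcases lt_abs.1 ht with h | h
    · exact b.zero_of_le_dist (by
        rw [Real.dist_eq]
        exact le_trans (show (1 / 2 : ℝ) ≤ t - 1 by linarith) (le_abs_self _))
    · exact hb t (by linarith)
  have hsmooth : ContDiff ℝ ∞ fun t : ℝ =>
      ((b t : ℝ) : ℂ) * Complex.exp (-γ * (Real.log t : ℝ)) := by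
    refine contDiff_iff_contDiffAt.2 fun t => ?_
    rcases le_or_gt t 0 with ht | ht
    · refine (contDiffAt_const (c := (0 : ℂ))).congr_of_eventuallyEq ?_
      filter_upwards [gt_mem_nhds (show t < 1 / 2 by linarith)] with s hs
      simp [hb s hs]
    · have h1 : ContDiffAt ℝ ∞ (fun t : ℝ => ((b t : ℝ) : ℂ)) t :=
        (Complex.ofRealCLM.contDiff.comp b.contDiff).contDiffAt
      have h2 : ContDiffAt ℝ ∞ (fun t : ℝ => ((Real.log t : ℝ) : ℂ)) t :=
        Complex.ofRealCLM.contDiff.contDiffAt.comp t (Real.contDiffAt_log.2 ht.ne')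
      exact h1.mul (contDiffAt_const.mul h2).cexp
  refine ⟨⟨_, mem_testFunctions_real hsmooth (R := 2) fun t ht => by simp [hb2 t ht]⟩,
    fun t ht => by simp [hb t ht], fun t ht => by simp [hb2 t ht], ?_⟩
  have h1 : ∫ t in Ioi (0 : ℝ), (t : ℂ) ^ γ *
      (((b t : ℝ) : ℂ) * Complex.exp (-γ * (Real.log t : ℝ))) = ((∫ t, b t : ℝ) : ℂ) := by
    rw [← setIntegral_eq_integral_of_forall_compl_eq_zero (s := Ioi (0 : ℝ)) (f := b)
      (fun t ht => hb t (by simp only [mem_Ioi, not_lt] at ht; linarith)),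
      ← integral_complex_ofReal]
    refine setIntegral_congr_fun measurableSet_Ioi fun t ht => ?_
    have ht' : (t : ℂ) ≠ 0 := by exact_mod_cast (ne_of_gt ht)
    rw [Complex.cpow_def_of_ne_zero ht', ← Complex.ofReal_log (le_of_lt ht), mul_left_comm,
      ← Complex.exp_add]
    simp [mul_comm]
  refine h1.symm ▸ ?_
  exact_mod_cast (b.integral_pos (μ := volume)).ne'

theorem tMinus_eq_zero_of_support (a : ℂ) {χ : testFunctions 𝓘(ℝ, ℝ) ℝ}
    (h0 : ∀ t < 1 / 2, (χ : ℝ → ℂ) t = 0) : (tMinus a).1 χ = 0 := by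
  have hz : ∀ (k : ℕ) (t : ℝ), 0 < t → iteratedDeriv k (pullback reflection χ : ℝ → ℂ) t = 0 := by
    intro k t ht
    have : (pullback reflection χ : ℝ → ℂ) =ᶠ[𝓝 t] fun _ => 0 := by
      filter_upwards [lt_mem_nhds ht] with s hs
      exact h0 (-s) (by linarith)
    rw [this.iteratedDeriv_eq]
    simp
  have hi : ∀ (w : ℝ → ℂ) (k : ℕ), ∫ t in Ioi (0 : ℝ), w t *
      iteratedDeriv k (pullback reflection χ : ℝ → ℂ) t = 0 := fun w k =>
    setIntegral_eq_zero_of_forall_eq_zero fun t ht => by rw [hz k t ht, mul_zero]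
  change (tPlus a).1 (pullback reflection χ) = 0
  by_cases ha : ∃ n : ℕ, a = -(n : ℂ)
  · obtain ⟨n, rfl⟩ := ha
    rw [tPlus_neg_apply, hi, mul_zero]
  · push Not at ha
    rw [tPlus_apply_of_ne ha, hi, mul_zero]

theorem exists_tPlus_ne_zero (a : ℂ) : ∃ χ : testFunctions 𝓘(ℝ, ℝ) ℝ,
    (∀ t < 1 / 2, (χ : ℝ → ℂ) t = 0) ∧ (tPlus a).1 χ ≠ 0 := by
  have hhalf : (0 : ℝ) < 1 / 2 := by norm_num
  by_cases ha : ∃ n : ℕ, a = -(n : ℂ)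
  · obtain ⟨n, rfl⟩ := ha
    obtain ⟨χ, h0, h2, hχ⟩ := exists_integral_cpow_ne_zero (-1 - n)
    obtain ⟨c, hc, hint⟩ := integral_cpow_mul_iteratedDeriv (R := 2) hhalf n (β := -1)
      fun j _ h => by
        have : ((j + 1 : ℕ) : ℂ) = 0 := by push_cast; linear_combination -h
        exact Nat.succ_ne_zero j (by exact_mod_cast this)
    refine ⟨χ, h0, ?_⟩
    have hsm := (testFunctions_real_contDiff χ)
    have hd0 : ∀ t < (1 / 2 : ℝ), iteratedDeriv n (χ : ℝ → ℂ) t = 0 := fun t ht => by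
      have : (χ : ℝ → ℂ) =ᶠ[𝓝 t] fun _ => 0 := by
        filter_upwards [gt_mem_nhds ht] with s hs
        exact h0 s hs
      rw [this.iteratedDeriv_eq]
      simp
    rw [tPlus_neg_apply, iteratedDeriv_succ,
      integral_mul_deriv_of_support (f := fun t : ℝ => ((Real.log t : ℝ) : ℂ))
        (f' := fun t : ℝ => (t : ℂ) ^ (-1 : ℂ)) (fun t ht => by
          rw [Complex.cpow_neg_one, ← Complex.ofReal_inv]
          exact (Real.hasDerivAt_log ht.ne').ofReal_comp)
        (fun t ht => (Complex.continuousAt_ofReal_cpow_const t _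
          (Or.inr (ne_of_gt ht))).continuousWithinAt)
        (by rw [iteratedDeriv_eq_iterate]; exact hsm.iterate_deriv n) hhalf hd0
        (iteratedDeriv_eq_zero_of_support h2 n), hint _ hsm h0 h2]
    exact mul_ne_zero (logCoeff_ne_zero n) (neg_ne_zero.2 (mul_ne_zero hc hχ))
  · push Not at ha
    obtain ⟨χ, h0, h2, hχ⟩ := exists_integral_cpow_ne_zero (a - 1 + order a - order a)
    obtain ⟨c, hc, hint⟩ := integral_cpow_mul_iteratedDeriv (R := 2) hhalf (order a)
      (β := a - 1 + order a) fun j hj h => by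
        refine ha (order a - 1 - j) ?_
        have h1 : ((order a - 1 - j : ℕ) : ℂ) = order a - 1 - j := by
          rw [Nat.cast_sub (by omega), Nat.cast_sub (by omega), Nat.cast_one]
        rw [h1]
        linear_combination h
    refine ⟨χ, h0, ?_⟩
    rw [tPlus_apply_of_ne ha, hint _ (testFunctions_real_contDiff χ) h0 h2]
    exact mul_ne_zero (tPlus_coeff_ne_zero ha) (mul_ne_zero hc hχ)

theorem exists_diracDeriv_ne_zero (n : ℕ) :
    ∃ χ : testFunctions 𝓘(ℝ, ℝ) ℝ, (diracDeriv n).1 χ ≠ 0 := by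
  obtain ⟨κ, hκ⟩ := exists_cutoff 1
  obtain ⟨R, hR⟩ := exists_bound_support κ
  have hsm : ContDiff ℝ ∞ fun t : ℝ => (t : ℂ) ^ n * (κ : ℝ → ℂ) t :=
    (Complex.ofRealCLM.contDiff.pow n).mul (testFunctions_real_contDiff κ)
  refine ⟨⟨_, mem_testFunctions_real hsm (R := R) fun t ht => by rw [hR t ht, mul_zero]⟩, ?_⟩
  have h1 : (fun t : ℝ => (t : ℂ) ^ n * (κ : ℝ → ℂ) t) =ᶠ[𝓝 0] fun t : ℝ => ((t ^ n : ℝ) : ℂ) := by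
    filter_upwards [Metric.closedBall_mem_nhds (0 : ℝ) one_pos] with t ht
    rw [hκ t (by simpa using ht), mul_one, Complex.ofReal_pow]
  have h2 : ∀ (k : ℕ) (f : ℝ → ℝ), ContDiff ℝ ∞ f → ∀ t,
      iteratedDeriv k (fun t => ((f t : ℝ) : ℂ)) t = ((iteratedDeriv k f t : ℝ) : ℂ) := by
    intro k
    induction k with
    | zero => intro f _ t; simp
    | succ k ih =>
      intro f hf t
      have h3 : deriv (fun t => ((f t : ℝ) : ℂ)) = fun t => ((deriv f t : ℝ) : ℂ) :=
        funext fun t => ((hf.differentiable (by simp) t).hasDerivAt.ofReal_comp).deriv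
      rw [iteratedDeriv_succ', iteratedDeriv_succ', h3, ih _ (contDiff_infty_iff_deriv.1 hf).2]
  change (-1) ^ n * iteratedDeriv n (fun t : ℝ => (t : ℂ) ^ n * (κ : ℝ → ℂ) t) 0 ≠ 0
  rw [h1.iteratedDeriv_eq, h2 n (fun t => t ^ n) (contDiff_id.pow n) 0]
  refine mul_ne_zero (pow_ne_zero _ (by norm_num)) ?_
  simp [Nat.descFactorial_self, Nat.factorial_ne_zero]

theorem diracDeriv_eq_zero_of_support (n : ℕ) {χ : testFunctions 𝓘(ℝ, ℝ) ℝ}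
    (h0 : ∀ t < 1 / 2, (χ : ℝ → ℂ) t = 0) : (diracDeriv n).1 χ = 0 := by
  have : (χ : ℝ → ℂ) =ᶠ[𝓝 0] fun _ => 0 := by
    filter_upwards [gt_mem_nhds (show (0 : ℝ) < 1 / 2 by norm_num)] with s hs
    exact h0 s hs
  change (-1) ^ n * iteratedDeriv n (χ : ℝ → ℂ) 0 = 0
  rw [this.iteratedDeriv_eq]
  simp

end HalfLine

section Manifold

variable {E : Type*} [NormedAddCommGroup E] [NormedSpace ℝ E]
  {H : Type*} [TopologicalSpace H] {I : ModelWithCorners ℝ E H}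
  {M : Type*} [TopologicalSpace M] [ChartedSpace H M]
  [FiniteDimensional ℝ E] [I.Boundaryless] [IsManifold I ∞ M] [T2Space M]

theorem exists_eulerOp_of_tPlus_tMinus {a : ℂ} (ha : ∀ n : ℕ, a ≠ -(n : ℂ))
    {Ψ : testFunctions (I.prod 𝓘(ℝ, ℝ)) (M × ℝ)} (hp : ∀ p, (tPlus a).1 (slice Ψ p) = 0)
    (hm : ∀ p, (tMinus a).1 (slice Ψ p) = 0) : ∃ Θ, eulerOp a Θ = Ψ := by
  refine exists_eulerOp_of_iterate_timeDeriv (order a)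
    (fun j _ h => ha j (eq_neg_of_add_eq_zero_left h)) ?_
  have hexp : a + order a - 1 = a - 1 + order a := by ring
  refine exists_eulerOp_of_re_pos ?_ (fun p => ?_) fun p => ?_
  · have := neg_one_lt_re a
    simp only [Complex.add_re, Complex.sub_re, Complex.one_re] at this ⊢
    linarith
  · simp only [timeDeriv_iterate, hexp]
    have h := hp p
    rw [tPlus_apply_of_ne ha] at h
    exact (mul_eq_zero.1 h).resolve_left (tPlus_coeff_ne_zero ha)
  · simp only [timeDeriv_iterate, hexp]
    have h : (tPlus a).1 (pullback reflection (slice Ψ p)) = 0 := hm p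
    rw [tPlus_apply_of_ne ha] at h
    have h' := (mul_eq_zero.1 h).resolve_left (tPlus_coeff_ne_zero ha)
    simp only [iteratedDeriv_reflection, mul_left_comm _ ((-1 : ℂ) ^ order a),
      integral_const_mul] at h'
    exact (mul_eq_zero.1 h').resolve_left (pow_ne_zero _ (by norm_num))

theorem exists_eulerOp_of_odd_dirac (n : ℕ) {Ψ : testFunctions (I.prod 𝓘(ℝ, ℝ)) (M × ℝ)}
    (ho : ∀ p, (tPlus (-(n : ℂ)) + (-1 : ℂ) ^ (-(n : ℤ) - 1) • tMinus (-(n : ℂ))).1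
      (slice Ψ p) = 0)
    (hd : ∀ p, (diracDeriv n).1 (slice Ψ p) = 0) : ∃ Θ, eulerOp (-(n : ℂ)) Θ = Ψ := by
  refine exists_eulerOp_of_iterate_timeDeriv n (fun j hj h => ?_) ?_
  · rw [neg_add_eq_zero, Nat.cast_inj] at h
    exact hj.ne' h
  rw [neg_add_cancel]
  refine exists_eulerOp_zero (fun p => ?_) fun p => ?_
  · rw [timeDeriv_iterate]
    exact (mul_eq_zero.1 (hd p)).resolve_left (pow_ne_zero _ (by norm_num))
  · have h := ho p
    rw [odd_apply] at h
    simp only [← Function.iterate_succ_apply' timeDeriv, timeDeriv_iterate]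
    exact (mul_eq_zero.1 h).resolve_left (logCoeff_ne_zero n)

end Manifold

end HomDist

theorem mainTheorem8 {E : Type*} [NormedAddCommGroup E] [NormedSpace ℝ E] [FiniteDimensional ℝ E]
    {H : Type*} [TopologicalSpace H] (I : ModelWithCorners ℝ E H) [I.Boundaryless]
    (M : Type*) [TopologicalSpace M] [ChartedSpace H M] [IsManifold I ∞ M] [T2Space M] (a : ℂ) :
    ((∀ n : ℕ, a ≠ -(n : ℂ)) →
      HomDist.homogeneous (HomDist.dilation I M) a
          = HomDist.tensorSpace I M (HomDist.tPlus a) ⊔ HomDist.tensorSpace I M (HomDist.tMinus a) ∧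
        Disjoint (HomDist.tensorSpace I M (HomDist.tPlus a))
          (HomDist.tensorSpace I M (HomDist.tMinus a))) ∧
    (∀ n : ℕ, a = -(n : ℂ) →
      HomDist.homogeneous (HomDist.dilation I M) a
          = HomDist.tensorSpace I M
              (HomDist.tPlus a + (-1 : ℂ) ^ (-(n : ℤ) - 1) • HomDist.tMinus a) ⊔
            HomDist.tensorSpace I M (HomDist.diracDeriv n) ∧
        Disjoint
          (HomDist.tensorSpace I M
            (HomDist.tPlus a + (-1 : ℂ) ^ (-(n : ℤ) - 1) • HomDist.tMinus a))
          (HomDist.tensorSpace I M (HomDist.diracDeriv n))) := by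
  obtain ⟨χ, h0, hχ⟩ := HomDist.exists_tPlus_ne_zero a
  have hχ' := HomDist.tMinus_eq_zero_of_support a h0
  refine ⟨fun ha => ?_, ?_⟩
  · have hT := HomDist.lineHomogeneous_tPlus ha
    refine HomDist.homogeneous_eq_sup hT (HomDist.lineHomogeneous_tMinus hT) (χ₁ := χ)
      (χ₂ := HomDist.pullback HomDist.reflection χ) hχ hχ' ?_
      fun Ψ => HomDist.exists_eulerOp_of_tPlus_tMinus ha
    have h1 : HomDist.pullback HomDist.reflection (HomDist.pullback HomDist.reflection χ) = χ := by
      ext t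
      exact congrArg (χ : ℝ → ℂ) (neg_neg t)
    change (HomDist.tPlus a).1 (HomDist.pullback HomDist.reflection
      (HomDist.pullback HomDist.reflection χ)) ≠ 0
    rwa [h1]
  · rintro n rfl
    obtain ⟨χ₂, hχ₂⟩ := HomDist.exists_diracDeriv_ne_zero n
    refine HomDist.homogeneous_eq_sup (HomDist.lineHomogeneous_odd n)
      (HomDist.lineHomogeneous_diracDeriv n) (χ₁ := χ) (χ₂ := χ₂) ?_
      (HomDist.diracDeriv_eq_zero_of_support n h0) hχ₂
      fun Ψ => HomDist.exists_eulerOp_of_odd_dirac n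
    change (HomDist.tPlus (-(n : ℂ))).1 χ +
      (-1 : ℂ) ^ (-(n : ℤ) - 1) * (HomDist.tMinus (-(n : ℂ))).1 χ ≠ 0
    rwa [hχ', mul_zero, add_zero]
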